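/- Let $G=(V,E)$ be a (simple) graph, let $\kappa$ be an infinite cardinal, and let $A\subseteq V$ be a set of cardinality $\kappa$. A *path* in $G$ is a subgraph $P$ of $G$ together with a well ordering $\prec_P$ of $V(P)$ such that for every $v\in V(P)$ the set $\{w\in N_P(v): w\prec_P v\}$ is $\prec_P$-cofinal below $v$; its order type is the order type of $(V(P),\prec_P)$. A limit point of $P$ is a vertex of $P$ that is neither the $\prec_P$-first vertex nor an immediate $\prec_P$-successor. The path $P$ is *concentrated on $A$* if for every limit point $y$ of $P$ and every $x\prec_P y$ there is $z\in N_G(y)\cap A\cap V(P)$ with $x\preceq_P z\prec_P y$. The set $A$ is *$\kappa$-unseparable* if for any two distinct $v,w\in A$ there are $\kappa$ many finite paths from $v$ to $w$ in $G$ which pairwise meet only in $v$ and $w$. **Lemma 3.3.** Suppose that $A$ is $\kappa$-unseparable (and $|A|=\kappa\ge\omega$, as above). Then the following are equivalent: 1. there is a path $P$ in $G$ of order type $\kappa$ concentrated on $A$; 2. there is a path $Q$ in $G$ of order type $\kappa$ concentrated on $A$ with $A\subseteq V(Q)$. Moreover, if these conditions hold, then for every $a\in A$ and every $C\subseteq A$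 with $|C|=\mathrm{cf}(\kappa)$ the path $Q$ in (2) can be chosen so that its first point is $a$ and $C$ is $\prec_Q$-cofinal in $V(Q)$. -/

import Mathlib

open Cardinal

universe u

/-- A set `A` of vertices is `κ`-unseparable in `G` if any two distinct points `v, w` of `A` are
joined by `κ`-many finite paths of `G` which pairwise meet only in `v` and `w`. -/
def IsUnseparable {V : Type u} (G : SimpleGraph V) (κ : Cardinal.{u}) (A : Set V) : Prop :=
  ∀ v ∈ A, ∀ w ∈ A, v ≠ w → ∃ S : Set (G.Path v w), #S = κ ∧
    S.Pairwise fun p q => ∀ x, x ∈ p.1.support → x ∈ q.1.support → x = v ∨ x = w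

/-- `lt` witnesses that the graph `P` is a (possibly transfinite) path in the sense of Rado:
it is a well ordering of the vertices of `P`, and for every vertex `v` the set of neighbours of
`v` preceding `v` is cofinal below `v`. -/
structure IsPathOrder {W : Type u} (P : SimpleGraph W) (lt : W → W → Prop) : Prop where
  isWellOrder : IsWellOrder W lt
  cofinal_below : ∀ v u, lt u v → ∃ w, P.Adj v w ∧ lt w v ∧ (w = u ∨ lt u w)

/-- A path in `G` in the sense of Rado: a subgraph of `G` together with a well ordering of its
vertices witnessing that it is a path. -/
structure RadoPath {V : Type u} (G : SimpleGraph V) where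
  graph : G.Subgraph
  lt : graph.verts → graph.verts → Prop
  isPathOrder : IsPathOrder graph.coe lt

namespace RadoPath

variable {V : Type u} {G : SimpleGraph V}

instance (P : RadoPath G) : IsWellOrder P.graph.verts P.lt := P.isPathOrder.isWellOrder

/-- The order type of a path. -/
noncomputable def orderType (P : RadoPath G) : Ordinal.{u} := Ordinal.type P.lt

/-- `y` is a limit point of the path: neither its first point nor an immediate successor. -/
def IsLimitPoint (P : RadoPath G) (y : P.graph.verts) : Prop :=
  (∃ x, P.lt x y) ∧ ∀ x, P.lt x y → ∃ z, P.lt x z ∧ P.lt z y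

/-- The path is concentrated on `A`: for every limit point `y` and every `x` preceding `y`, some
neighbour of `y` in `G` lies in `A` and in the segment `[x, y)` of the path. -/
def ConcentratedOn (P : RadoPath G) (A : Set V) : Prop :=
  ∀ y, P.IsLimitPoint y → ∀ x, P.lt x y →
    ∃ z : P.graph.verts, G.Adj y z ∧ (z : V) ∈ A ∧ (z = x ∨ P.lt x z) ∧ P.lt z y

/-- The vertices of the path cover `A`. -/
def Covers (P : RadoPath G) (A : Set V) : Prop := A ⊆ P.graph.verts

/-- `a` is the first point of the path. -/
def IsFirstPoint (P : RadoPath G) (a : V) : Prop :=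
  ∃ h : a ∈ P.graph.verts, ∀ x, ¬ P.lt x ⟨a, h⟩

/-- `C` is a cofinal set of points of the path. -/
def IsCofinalSet (P : RadoPath G) (C : Set V) : Prop :=
  C ⊆ P.graph.verts ∧
    ∀ x : P.graph.verts, ∃ c : P.graph.verts, (c : V) ∈ C ∧ (c = x ∨ P.lt x c)

end RadoPath

/-! Paths become injective ordinal sequences (`IsSeq`), and unseparability becomes `Joins`: points
of `A` stay connected after deleting fewer than `κ` vertices. `Reroutable` is then proved by
induction on `κ`. For `ℵ₀`, finite paths are extended greedily.

For `κ > ℵ₀`, a continuous increasing chain of `cf κ` vertex sets `M i`, each smaller than `κ`, is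
built, and every layer `M (i + 1) \ M i` is filled by a block of length `μ` for some infinite `μ <
κ`. The layer is closed under joining paths (`Joins.exists_closure`) and contains a segment of
length `μ` of the given path `p`, so the inductive hypothesis reroutes that segment through all of
`A` in the layer (`IsStage.exists_step`). The vertex of `p` just after the segment is a limit, so at
least `cf μ` points of `A` in the segment are its neighbours; making `cf μ` of them cofinal in the
block allows this vertex to start the next block. This is why the induction carries a first point
and a cofinal set.

At a limit stage a start with neighbours in `A` cofinal in the union is needed. For regular `κ` the
sets absorb initial segments of `p`, and the next vertex of `p` serves. For singular `κ` a segment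
of `p` of length `ω * cf κ` is reserved beforehand and released stage by stage, together with `cf κ`
points of `C`. The concatenated blocks have order type `κ`: they cover `A`, and each proper initial
segment lies in some `M i` (`exists_isSeq_of_blocks`). -/

section TransfinitePaths

open Ordinal Set

variable {V : Type u}

/-! ### Cardinal estimates and ordinal enumerations. -/

theorem mk_image_Iio_le (f : Ordinal.{u} → V) (o : Ordinal.{u}) : #(f '' Iio o) ≤ o.card := by
  have h := Cardinal.mk_image_le_lift (f := f) (s := Iio o)
  rw [Cardinal.mk_Iio_ordinal, Cardinal.lift_lift] at h
  exact Cardinal.lift_le.1 h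

theorem card_le_mk_of_injOn {f : Ordinal.{u} → V} {o : Ordinal.{u}} {B : Set V}
    (hf : InjOn f (Iio o)) (hB : MapsTo f (Iio o) B) : o.card ≤ #B := by
  have h := Cardinal.mk_image_eq_of_injOn_lift f (Iio o) hf
  rw [Cardinal.mk_Iio_ordinal, Cardinal.lift_lift] at h
  have h1 : #(f '' Iio o) = o.card := Cardinal.lift_injective h
  rw [← h1]
  exact Cardinal.mk_le_mk_of_subset (image_subset_iff.2 hB)

theorem mk_union_lt {κ : Cardinal.{u}} (hκ : ℵ₀ ≤ κ) {A B : Set V} (hA : #A < κ) (hB : #B < κ) :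
    #(A ∪ B : Set V) < κ :=
  (Cardinal.mk_union_le A B).trans_lt (Cardinal.add_lt_of_lt hκ hA hB)

theorem mk_union_le_of_le {κ : Cardinal.{u}} (hκ : ℵ₀ ≤ κ) {A B : Set V} (hA : #A ≤ κ)
    (hB : #B ≤ κ) : #(A ∪ B : Set V) ≤ κ :=
  (Cardinal.mk_union_le A B).trans (Cardinal.add_le_of_le hκ hA hB)

theorem mk_lt_of_subset {κ : Cardinal.{u}} {A B : Set V} (h : A ⊆ B) (hB : #B < κ) : #A < κ :=
  (Cardinal.mk_le_mk_of_subset h).trans_lt hB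

theorem biUnion_Iio_eq (o : Ordinal.{u}) (M : Ordinal.{u} → Set V) :
    (⋃ i < o, M i) = ⋃ x : o.ToType, M x.toOrd := by
  ext v
  simp only [mem_iUnion]
  constructor
  · rintro ⟨i, hi, hv⟩
    exact ⟨ToType.mk ⟨i, hi⟩, by simpa using hv⟩
  · rintro ⟨x, hv⟩
    exact ⟨_, x.toOrd.2, hv⟩

theorem mk_biUnion_Iio_lt {κ : Cardinal.{u}} (hκ : ℵ₀ ≤ κ) {o : Ordinal.{u}}
    (ho : o < κ.ord.cof.ord) {M : Ordinal.{u} → Set V}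
    (h : ∀ i < o, #(M i) < κ) : #(⋃ i < o, M i : Set V) < κ := by
  rw [biUnion_Iio_eq]
  refine (Cardinal.mk_iUnion_le _).trans_lt ?_
  have ho' : o.card < κ.ord.cof := Cardinal.lt_ord.1 ho
  rw [Cardinal.mk_toType]
  refine Cardinal.mul_lt_of_lt hκ (ho'.trans_le (cof_ord_le κ)) ?_
  refine Cardinal.iSup_lt_of_lt_cof_ord ?_ fun x => h _ x.toOrd.2
  rwa [Cardinal.mk_toType]

theorem exists_surjOn_Iio_ord {A : Set V} {κ : Cardinal.{u}} (h : #A ≤ κ) (a : V) (ha : a ∈ A) :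
    ∃ α : Ordinal.{u} → V, (∀ i, α i ∈ A) ∧ ∀ x ∈ A, ∃ i < κ.ord, α i = x := by
  classical
  obtain ⟨r, wo, hr⟩ := Cardinal.exists_ord_eq A
  refine ⟨fun i => if h : i < type r then (enum r ⟨i, h⟩ : A) else a, fun i => ?_, fun x hx => ?_⟩
  · dsimp only
    split_ifs
    · exact Subtype.coe_prop _
    · exact ha
  · refine ⟨typein r ⟨x, hx⟩, ?_, ?_⟩
    · exact (typein_lt_type r _).trans_le (hr ▸ Cardinal.ord_le_ord.2 h)
    · simp [typein_lt_type]

theorem exists_injOn_Iio_ord {A : Set V} {κ : Cardinal.{u}} (h : κ ≤ #A) (a : V) :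
    ∃ α : Ordinal.{u} → V, InjOn α (Iio κ.ord) ∧ ∀ i < κ.ord, α i ∈ A := by
  classical
  obtain ⟨r, wo, hr⟩ := Cardinal.exists_ord_eq A
  have hlt : ∀ i < κ.ord, i < type r := fun i hi => hi.trans_le (hr ▸ Cardinal.ord_le_ord.2 h)
  refine ⟨fun i => if h : i < type r then (enum r ⟨i, h⟩ : A) else a, fun i hi j hj hij => ?_,
    fun i hi => ?_⟩
  · simp only [hlt i hi, hlt j hj, dif_pos] at hij
    have := (enum r).injective (Subtype.ext hij)
    exact congrArg Subtype.val this
  · simp only [hlt i hi, dif_pos]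
    exact Subtype.coe_prop _

/-! ### Transfinite sequences and the statement proved by induction. -/

/-- The ordinals below `o` enumerate, via `q`, a transfinite path of `G` concentrated on `A`. -/
structure IsSeq (G : SimpleGraph V) (A : Set V) (o : Ordinal.{u}) (q : Ordinal.{u} → V) : Prop where
  injOn : InjOn q (Iio o)
  adj : ∀ η < o, ∀ ξ < η, ∃ ζ, ξ ≤ ζ ∧ ζ < η ∧ G.Adj (q η) (q ζ) ∧ (q ζ ∈ A ∨ η = ζ + 1)

/-- Distinct points of `A` are joined by paths inside `X` with interior avoiding any prescribed set
of fewer than `κ` vertices. -/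
def Joins (G : SimpleGraph V) (A X : Set V) (κ : Cardinal.{u}) : Prop :=
  ∀ v ∈ A, ∀ w ∈ A, v ≠ w → ∀ F : Set V, #F < κ → ∃ p : G.Walk v w, p.IsPath ∧
    (∀ x ∈ p.support, x ∈ X) ∧ ∀ x ∈ p.support, x ∈ F → x = v ∨ x = w

/-- A `κ`-path concentrated on `A` can be rerouted to cover `A`, with prescribed first point and
prescribed cofinal set. -/
def Reroutable (V : Type u) (κ : Cardinal.{u}) : Prop :=
  ∀ (G : SimpleGraph V) (X A : Set V), A ⊆ X → #A ≤ κ → Joins G A X κ →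
    ∀ p : Ordinal.{u} → V, IsSeq G A κ.ord p → (∀ ξ < κ.ord, p ξ ∈ X) →
    ∀ a ∈ A, ∀ C ⊆ A, #C = κ.ord.cof →
    ∃ q : Ordinal.{u} → V, IsSeq G A κ.ord q ∧ (∀ ξ < κ.ord, q ξ ∈ X) ∧
      (∀ x ∈ A, ∃ ξ < κ.ord, q ξ = x) ∧ q 0 = a ∧
      ∀ ξ < κ.ord, ∃ η, ξ ≤ η ∧ η < κ.ord ∧ q η ∈ C

namespace IsSeq

variable {G : SimpleGraph V} {A : Set V} {o : Ordinal.{u}} {q : Ordinal.{u} → V}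

theorem mono {B : Set V} (h : IsSeq G A o q) (hAB : A ⊆ B) : IsSeq G B o q :=
  ⟨h.injOn, fun η hη ξ hξ => by
    obtain ⟨ζ, h1, h2, h3, h4⟩ := h.adj η hη ξ hξ
    exact ⟨ζ, h1, h2, h3, h4.imp_left fun h => hAB h⟩⟩

theorem inter {B : Set V} (h : IsSeq G A o q) (hB : ∀ ξ < o, q ξ ∈ B) : IsSeq G (A ∩ B) o q :=
  ⟨h.injOn, fun η hη ξ hξ => by
    obtain ⟨ζ, h1, h2, h3, h4⟩ := h.adj η hη ξ hξ
    exact ⟨ζ, h1, h2, h3, h4.imp_left fun h => ⟨h, hB ζ (h2.trans hη)⟩⟩⟩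

theorem shift (h : IsSeq G A o q) (ρ l : Ordinal.{u}) (hl : ρ + l ≤ o) :
    IsSeq G A l fun ξ => q (ρ + ξ) := by
  have hlt : ∀ ξ < l, ρ + ξ < o := fun ξ hξ => (add_lt_add_right hξ ρ).trans_le hl
  refine ⟨fun ξ hξ η hη he => ?_, fun η hη ξ hξ => ?_⟩
  · exact add_left_cancel (h.injOn (hlt ξ hξ) (hlt η hη) he)
  · obtain ⟨ζ, h1, h2, h3, h4⟩ := h.adj (ρ + η) (hlt η hη) (ρ + ξ) (add_lt_add_right hξ ρ)
    have hζ : ρ + (ζ - ρ) = ζ := Ordinal.add_sub_cancel_of_le (le_self_add.trans h1)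
    refine ⟨ζ - ρ, ?_, ?_, by rwa [hζ], ?_⟩
    · rw [← hζ] at h1
      exact le_of_add_le_add_left h1
    · rw [← hζ] at h2
      exact lt_of_add_lt_add_left h2
    · rw [hζ]
      refine h4.imp_right fun h4 => ?_
      rw [← hζ, add_assoc] at h4
      exact add_left_cancel h4

/-- The alternative `η = ζ + 1` in `IsSeq.adj` is void at a limit, so concentration on `A` is what
remains there. -/
theorem exists_adj_of_isSuccLimit (h : IsSeq G A o q) {η ξ : Ordinal.{u}} (hη : η < o)
    (hl : Order.IsSuccLimit η) (hξ : ξ < η) :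
    ∃ ζ, ξ ≤ ζ ∧ ζ < η ∧ G.Adj (q η) (q ζ) ∧ q ζ ∈ A := by
  obtain ⟨ζ, h1, h2, h3, h4⟩ := h.adj η hη ξ hξ
  refine ⟨ζ, h1, h2, h3, h4.resolve_right ?_⟩
  rintro rfl
  exact (hl.add_one_lt h2).ne rfl

theorem adj_add_one (h : IsSeq G A o q) {η : Ordinal.{u}} (hη : η + 1 < o) :
    G.Adj (q η) (q (η + 1)) := by
  obtain ⟨ζ, h1, h2, h3, -⟩ := h.adj (η + 1) hη η (lt_add_one η)
  obtain rfl : η = ζ := le_antisymm h1 (Order.lt_add_one_iff.1 h2)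
  exact h3.symm

/-- Among the points following `η` there is one of `A` at finite distance. -/
theorem exists_add_nat_mem (h : IsSeq G A o q) {η : Ordinal.{u}} (hη : η + ω < o) :
    ∃ n : ℕ, q (η + n) ∈ A := by
  obtain ⟨ζ, h1, h2, -, h4⟩ := h.exists_adj_of_isSuccLimit hη
    (Ordinal.isSuccLimit_add η isSuccLimit_omega0) (ξ := η) (by simp [omega0_pos])
  have hζ : η + (ζ - η) = ζ := Ordinal.add_sub_cancel_of_le h1
  rw [← hζ] at h2
  obtain ⟨n, hn⟩ := lt_omega0.1 (lt_of_add_lt_add_left h2)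
  exact ⟨n, by rwa [← hn, hζ]⟩

/-- A set of fewer than `κ` vertices misses long intervals of a sequence of length `κ`. -/
theorem exists_interval {κ : Cardinal.{u}} (hκ : ℵ₀ ≤ κ) {p : Ordinal.{u} → V}
    (hp : InjOn p (Iio κ.ord)) {B : Set V} (hB : #B < κ) {l : Ordinal.{u}} (hl : l < κ.ord) :
    ∃ ρ, ρ + l < κ.ord ∧ ∀ ξ < l, p (ρ + ξ) ∉ B := by
  rcases eq_or_ne l 0 with rfl | hl0
  · exact ⟨0, by simpa using hl, fun ξ hξ => absurd hξ (by simp)⟩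
  have hmul : ∀ ξ < κ.ord, l * ξ < κ.ord := fun ξ hξ => isPrincipal_mul_ord hκ hl hξ
  -- The intervals `[l * ξ, l * ξ + l)`, for `ξ < κ.ord`, are disjoint; if all of them met `B`, then
  -- `κ` would inject into `B`.
  by_contra! hcon
  have hbad : ∀ ξ < κ.ord, ∃ η < l, p (l * ξ + η) ∈ B := fun ξ hξ =>
    hcon (l * ξ) (isPrincipal_add_ord hκ (hmul ξ hξ) hl)
  choose! g hg hgB using hbad
  have := card_le_mk_of_injOn (f := fun ξ => p (l * ξ + g ξ)) (o := κ.ord) (B := B) ?_ hgB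
  · rw [card_ord] at this
    exact this.not_gt hB
  · intro ξ hξ η hη he
    have h1 := hp (isPrincipal_add_ord hκ (hmul ξ hξ) ((hg ξ hξ).trans hl))
      (isPrincipal_add_ord hκ (hmul η hη) ((hg η hη).trans hl)) he
    have h2 := congrArg (· / l) h1
    simpa [Ordinal.mul_add_div _ hl0, Ordinal.div_eq_zero_of_lt (hg ξ hξ),
      Ordinal.div_eq_zero_of_lt (hg η hη)] using h2

/-- Fewer than `κ` vertices miss an interval of length `ω`, but every such interval contains a point
of `A`. -/
theorem le_mk {κ : Cardinal.{u}} (hκ : ℵ₀ < κ) {p : Ordinal.{u} → V} (hp : IsSeq G A κ.ord p) :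
    κ ≤ #A := by
  by_contra! hA
  have hω : ω < κ.ord := by rwa [Cardinal.lt_ord, card_omega0]
  obtain ⟨ρ, h1, h2⟩ := exists_interval hκ.le hp.injOn hA hω
  obtain ⟨n, hn⟩ := hp.exists_add_nat_mem h1
  exact h2 n (natCast_lt_omega0 n) hn

end IsSeq

/-! ### Small vertex sets closed under joining paths. -/

theorem SimpleGraph.Walk.mk_support_lt_aleph0 {G : SimpleGraph V} {v w : V} (p : G.Walk v w) :
    #{x | x ∈ p.support} < ℵ₀ :=
  Cardinal.lt_aleph0_iff_set_finite.2 p.support.finite_toSet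

namespace Joins

variable {G : SimpleGraph V} {A X : Set V} {κ μ : Cardinal.{u}}

/-- Inside a set of at most `μ` vertices one can still join `v` and `w` while avoiding any fewer
than `μ` vertices. -/
theorem exists_hub (h : Joins G A X κ) (hμ : ℵ₀ ≤ μ) (hμκ : μ < κ) {B : Set V} (hB : #B < κ)
    {v w : V} (hv : v ∈ A) (hw : w ∈ A) (hvw : v ≠ w) :
    ∃ T : Set V, #T ≤ μ ∧ T ⊆ X ∧ (∀ x ∈ T, x ∈ B → x = v ∨ x = w) ∧
      ∀ F : Set V, #F < μ → ∃ p : G.Walk v w, p.IsPath ∧ (∀ x ∈ p.support, x ∈ T) ∧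
        ∀ x ∈ p.support, x ∈ F → x = v ∨ x = w := by
  have hκ : ℵ₀ ≤ κ := hμ.trans hμκ.le
  have hg : ∀ F : Set V, ∃ p : G.Walk v w, #F < κ → p.IsPath ∧ (∀ x ∈ p.support, x ∈ X) ∧
      ∀ x ∈ p.support, x ∈ F → x = v ∨ x = w := by
    intro F
    by_cases hF : #F < κ
    · obtain ⟨p, hp⟩ := h v hv w hw hvw F hF
      exact ⟨p, fun _ => hp⟩
    · obtain ⟨p, -⟩ := h v hv w hw hvw ∅ (by simpa using aleph0_pos.trans_le hκ)
      exact ⟨p, fun h => absurd h hF⟩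
  choose g hg using hg
  -- Recursion of length `μ`: each path avoids `B` and all earlier paths except at `v` and `w`. The
  -- interiors are disjoint, so fewer than `μ` vertices cannot meet all of them.
  let f : μ.ord.ToType → G.Walk v w := WellFoundedLT.fix fun x rec =>
    g (B ∪ ⋃ y : Iio x, {z | z ∈ (rec y.1 y.2).support})
  have hf : ∀ x, f x = g (B ∪ ⋃ y : Iio x, {z | z ∈ (f y.1).support}) := fun x =>
    WellFoundedLT.fix_eq _ x
  have hsub : ∀ s : Set μ.ord.ToType, #(⋃ y : s, {z | z ∈ (f y.1).support} : Set V) ≤ μ := by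
    intro s
    refine (Cardinal.mk_iUnion_le _).trans ?_
    refine Cardinal.mul_le_of_le hμ ?_ ?_
    · exact (Cardinal.mk_set_le s).trans (by rw [Cardinal.mk_toType, card_ord])
    · exact (ciSup_le' fun y => (SimpleGraph.Walk.mk_support_lt_aleph0 _).le).trans hμ
  have hsize : ∀ x, #(B ∪ ⋃ y : Iio x, {z | z ∈ (f y.1).support} : Set V) < κ := fun x =>
    mk_union_lt hκ hB ((hsub _).trans_lt hμκ)
  have hspec : ∀ x, (f x).IsPath ∧ (∀ z ∈ (f x).support, z ∈ X) ∧
      ∀ z ∈ (f x).support, z ∈ (B ∪ ⋃ y : Iio x, {z | z ∈ (f y.1).support} : Set V) →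
        z = v ∨ z = w := by
    intro x
    have := hg _ (hsize x)
    rwa [← hf x] at this
  refine ⟨⋃ y : (univ : Set μ.ord.ToType), {z | z ∈ (f y.1).support}, hsub _, ?_, ?_, ?_⟩
  · intro z hz
    obtain ⟨y, hy⟩ := mem_iUnion.1 hz
    exact (hspec y.1).2.1 z hy
  · intro z hz hzB
    obtain ⟨y, hy⟩ := mem_iUnion.1 hz
    exact (hspec y.1).2.2 z hy (Or.inl hzB)
  · intro F hF
    by_contra! hcon
    have hbad : ∀ x, ∃ z ∈ (f x).support, z ∈ F ∧ z ≠ v ∧ z ≠ w := fun x =>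
      hcon (f x) (hspec x).1 fun z hz => mem_iUnion.2 ⟨⟨x, mem_univ x⟩, hz⟩
    choose z hz hzF hzv hzw using hbad
    have hne : ∀ x y, x < y → z x ≠ z y := by
      intro x y hxy he
      rcases (hspec y).2.2 (z y) (hz y)
        (Or.inr (mem_iUnion.2 ⟨⟨x, hxy⟩, he ▸ hz x⟩)) with h | h
      · exact hzv y h
      · exact hzw y h
    have hinj : Function.Injective fun x => (⟨z x, hzF x⟩ : F) := by
      intro x y he
      by_contra hxy
      rcases lt_or_gt_of_ne hxy with h | h
      · exact hne x y h (congrArg Subtype.val he)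
      · exact hne y x h (congrArg Subtype.val he).symm
    have := Cardinal.mk_le_of_injective hinj
    rw [Cardinal.mk_toType, card_ord] at this
    exact this.not_gt hF

/-- A closure argument: hubs for all pairs from `A` are added `ω` times, which keeps the size at
most `μ`. The set `M` is excluded outright, whereas points of `R` are admitted only if they come
from `Z`. -/
theorem exists_closure (h : Joins G A X κ) (hμ : ℵ₀ ≤ μ) (hμκ : μ < κ) {M Z R : Set V}
    (hM : #M < κ) (hR : #R < κ) (hZ : #Z ≤ μ) (hZX : Z ⊆ X) :
    ∃ D ⊆ X, (∀ x ∈ D, x ∉ M) ∧ #D ≤ μ ∧ Z \ M ⊆ D ∧ (∀ x ∈ D, x ∈ R → x ∈ Z) ∧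
      Joins G (A ∩ D) D μ := by
  have hκ : ℵ₀ ≤ κ := hμ.trans hμκ.le
  have hT : ∀ v w, v ∈ A → w ∈ A → v ≠ w → _ := fun v w hv hw hvw =>
    h.exists_hub hμ hμκ (mk_union_lt hκ hM hR) hv hw hvw
  choose! T hTc hTX hTB hTp using hT
  let st : Set V → Set V := fun E =>
    E ∪ ⋃ x : {x : E × E // (x.1 : V) ∈ A ∧ (x.2 : V) ∈ A ∧ (x.1 : V) ≠ x.2}, T x.1.1 x.1.2
  let D : ℕ → Set V := fun n => st^[n] (Z \ M)
  have hsucc : ∀ n, D (n + 1) = st (D n) := fun n => Function.iterate_succ_apply' st n _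
  have hmono : Monotone D := monotone_nat_of_le_succ fun n => by
    rw [hsucc]
    exact subset_union_left
  have key : ∀ n, #(D n) ≤ μ ∧ ∀ x ∈ D n, x ∈ X ∧ x ∉ M ∧ (x ∈ R → x ∈ Z) := by
    intro n
    induction n with
    | zero => exact ⟨(Cardinal.mk_le_mk_of_subset sdiff_subset).trans hZ,
        fun x hx => ⟨hZX hx.1, hx.2, fun _ => hx.1⟩⟩
    | succ n ih =>
      rw [hsucc]
      refine ⟨mk_union_le_of_le hμ ih.1 ?_, ?_⟩
      · refine (Cardinal.mk_iUnion_le _).trans (Cardinal.mul_le_of_le hμ ?_ ?_)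
        · refine (Cardinal.mk_subtype_le _).trans ?_
          rw [← Cardinal.mul_def]
          exact Cardinal.mul_le_of_le hμ ih.1 ih.1
        · exact ciSup_le' fun x => hTc _ _ x.2.1 x.2.2.1 x.2.2.2
      · rintro x (hx | hx)
        · exact ih.2 x hx
        · obtain ⟨y, hy⟩ := mem_iUnion.1 hx
          have hB := hTB _ _ y.2.1 y.2.2.1 y.2.2.2 x hy
          refine ⟨hTX _ _ y.2.1 y.2.2.1 y.2.2.2 hy, fun hxM => ?_, fun hxR => ?_⟩
          · rcases hB (Or.inl hxM) with rfl | rfl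
            · exact (ih.2 _ y.1.1.2).2.1 hxM
            · exact (ih.2 _ y.1.2.2).2.1 hxM
          · rcases hB (Or.inr hxR) with rfl | rfl
            · exact (ih.2 _ y.1.1.2).2.2 hxR
            · exact (ih.2 _ y.1.2.2).2.2 hxR
  have hmem : ∀ x, x ∈ (⋃ n : ULift.{u} ℕ, D n.down) → ∃ n, x ∈ D n := fun x hx => by
    obtain ⟨n, hn⟩ := mem_iUnion.1 hx
    exact ⟨n.down, hn⟩
  refine ⟨⋃ n : ULift.{u} ℕ, D n.down, fun x hx => ?_, fun x hx => ?_, ?_, ?_, fun x hx => ?_, ?_⟩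
  · obtain ⟨n, hn⟩ := hmem x hx
    exact ((key n).2 x hn).1
  · obtain ⟨n, hn⟩ := hmem x hx
    exact ((key n).2 x hn).2.1
  · refine (Cardinal.mk_iUnion_le _).trans (Cardinal.mul_le_of_le hμ ?_ ?_)
    · simpa using hμ
    · exact ciSup_le' fun n => (key n.down).1
  · exact fun x hx => mem_iUnion.2 ⟨⟨0⟩, hx⟩
  · obtain ⟨n, hn⟩ := hmem x hx
    exact ((key n).2 x hn).2.2
  · rintro v ⟨hv, hvD⟩ w ⟨hw, hwD⟩ hvw F hF
    obtain ⟨m, hm⟩ := hmem v hvD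
    obtain ⟨n, hn⟩ := hmem w hwD
    obtain ⟨p, hp, hpT, hpF⟩ := hTp v w hv hw hvw F hF
    refine ⟨p, hp, fun x hx => mem_iUnion.2 ⟨⟨max m n + 1⟩, ?_⟩, hpF⟩
    change x ∈ D (max m n + 1)
    rw [hsucc]
    exact Or.inr (mem_iUnion.2 ⟨⟨(⟨v, hmono (le_max_left m n) hm⟩, ⟨w, hmono (le_max_right m n) hn⟩),
      hv, hw, hvw⟩, hpT x hx⟩)

/-- Allows a finite lead-in to be set aside before rerouting and prepended afterwards. -/
theorem diff_finite (h : Joins G A X κ) (hκ : ℵ₀ ≤ κ) {L : Set V} (hL : L.Finite) :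
    Joins G (A \ L) (X \ L) κ := by
  intro v hv w hw hvw F hF
  obtain ⟨p, hp, hpX, hpF⟩ := h v hv.1 w hw.1 hvw (F ∪ L)
    (mk_union_lt hκ hF ((Cardinal.lt_aleph0_iff_set_finite.2 hL).trans_le hκ))
  refine ⟨p, hp, fun x hx => ⟨hpX x hx, fun hxL => ?_⟩, fun x hx hxF => hpF x hx (Or.inl hxF)⟩
  rcases hpF x hx (Or.inr hxL) with rfl | rfl
  · exact hv.2 hxL
  · exact hw.2 hxL

end Joins

/-! ### Prepending finite paths to sequences. -/

namespace IsSeq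

variable {G : SimpleGraph V} {A : Set V} {o : Ordinal.{u}} {q : Ordinal.{u} → V}

/-- The length remains `o`; for infinite `o` nothing is lost, since `1 + o = o`. -/
theorem exists_cons (h : IsSeq G A o q) {v : V} (hv : G.Adj v (q 0))
    (hne : ∀ ξ < o, q ξ ≠ v) :
    ∃ q' : Ordinal.{u} → V, IsSeq G A o q' ∧ q' 0 = v ∧ ∀ ξ, q' (1 + ξ) = q ξ := by
  classical
  let q' : Ordinal.{u} → V := fun ξ => if ξ = 0 then v else q (ξ - 1)
  have h0 : q' 0 = v := if_pos rfl
  have h1 : ∀ ξ, q' (1 + ξ) = q ξ := fun ξ => by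
    have : 1 + ξ ≠ 0 := by simp
    simp only [q', if_neg this, Ordinal.add_sub_cancel]
  have hcase : ∀ ξ < o, ξ = 0 ∨ ∃ η < o, ξ = 1 + η := fun ξ hξ => by
    refine or_iff_not_imp_left.2 fun h => ⟨ξ - 1, ?_, ?_⟩
    · exact (Ordinal.sub_le_self ξ 1).trans_lt hξ
    · exact (Ordinal.add_sub_cancel_of_le (Order.one_le_iff_pos.2 (pos_iff_ne_zero.2 h))).symm
  refine ⟨q', ⟨?_, ?_⟩, h0, h1⟩
  · intro ξ hξ η hη he
    rcases hcase ξ hξ with rfl | ⟨ξ, hξ', rfl⟩ <;> rcases hcase η hη with rfl | ⟨η, hη', rfl⟩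
    · rfl
    · rw [h0, h1] at he
      exact absurd he.symm (hne η hη')
    · rw [h0, h1] at he
      exact absurd he (hne ξ hξ')
    · rw [h1, h1] at he
      rw [h.injOn hξ' hη' he]
  · intro η hη ξ hξη
    rcases hcase η hη with rfl | ⟨η, hη', rfl⟩
    · exact absurd hξη (by simp)
    rcases eq_or_ne η 0 with rfl | hη0
    · refine ⟨0, ?_, by simp, ?_, Or.inr (by simp)⟩
      · exact (Order.lt_one_iff.1 (by simpa using hξη)).le
      · rw [h1, h0]
        exact hv.symm
    rcases hcase ξ (hξη.trans hη) with rfl | ⟨ξ, hξ', rfl⟩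
    · obtain ⟨ζ, -, h3, h4, h5⟩ := h.adj η hη' 0 (pos_iff_ne_zero.2 hη0)
      refine ⟨1 + ζ, by simp, add_lt_add_right h3 1, by rwa [h1, h1], ?_⟩
      rw [h1]
      exact h5.imp_right fun h => by rw [h, add_assoc]
    · obtain ⟨ζ, h2, h3, h4, h5⟩ := h.adj η hη' ξ (lt_of_add_lt_add_left hξη)
      refine ⟨1 + ζ, add_le_add_right h2 1, add_lt_add_right h3 1, by rwa [h1, h1], ?_⟩
      rw [h1]
      exact h5.imp_right fun h => by rw [h, add_assoc]

/-- A finite path ending in the first point of a sequence can be put in front of it. -/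
theorem exists_append (h : IsSeq G A o q) (ho : ω ≤ o) {b : V} (hb : q 0 = b) :
    ∀ l : List V, (l ++ [b]).IsChain G.Adj → l.Nodup → (∀ x ∈ l, ∀ ξ < o, q ξ ≠ x) →
    ∃ (q' : Ordinal.{u} → V) (n : ℕ), IsSeq G A o q' ∧ q' 0 = l.headD b ∧
      (∀ ξ, q' (n + ξ) = q ξ) ∧ (∀ ξ < o, q' ξ ∈ l ∨ ∃ η < o, q' ξ = q η) ∧
      ∀ x ∈ l, ∃ ξ < o, q' ξ = x := by
  intro l
  induction l with
  | nil => exact fun _ _ _ => ⟨q, 0, h, hb, by simp, fun ξ hξ => Or.inr ⟨ξ, hξ, rfl⟩, by simp⟩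
  | cons v l ih =>
    intro hc hn hd
    rw [List.cons_append] at hc
    obtain ⟨q', n, h1, h2, h3, h4, h5⟩ := ih hc.tail (List.nodup_cons.1 hn).2
      fun x hx => hd x (List.mem_cons_of_mem _ hx)
    have hadj : G.Adj v (q' 0) := by
      rw [h2]
      cases l with
      | nil => simpa using hc
      | cons w l => exact (List.isChain_cons_cons.1 hc).1
    obtain ⟨q'', h6, h7, h8⟩ := h1.exists_cons hadj fun ξ hξ he => by
      rcases h4 ξ hξ with h | ⟨η, hη, h⟩
      · exact (List.nodup_cons.1 hn).1 (he ▸ h)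
      · exact hd v List.mem_cons_self η hη (h ▸ he)
    have hlt : ∀ ξ < o, 1 + ξ < o := fun ξ hξ => by
      have := add_lt_add_right hξ 1
      rwa [one_add_of_omega0_le ho] at this
    refine ⟨q'', n + 1, h6, by simpa using h7, fun ξ => ?_, fun ξ hξ => ?_, fun x hx => ?_⟩
    · rw [← h3, ← h8]
      congr 1
      rw [← add_assoc]
      congr 1
      exact_mod_cast Nat.add_comm n 1
    · rcases eq_or_ne ξ 0 with rfl | h0
      · left
        rw [h7]
        exact List.mem_cons_self
      · have he : ξ = 1 + (ξ - 1) :=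
          (Ordinal.add_sub_cancel_of_le (Order.one_le_iff_pos.2 (pos_iff_ne_zero.2 h0))).symm
        rw [he, h8]
        exact (h4 (ξ - 1) ((Ordinal.sub_le_self ξ 1).trans_lt hξ)).imp_left
          (List.mem_cons_of_mem _)
    · rcases List.mem_cons.1 hx with rfl | hx
      · exact ⟨0, omega0_pos.trans_le ho, h7⟩
      · obtain ⟨ξ, hξ, rfl⟩ := h5 x hx
        exact ⟨1 + ξ, hlt ξ hξ, h8 ξ⟩

end IsSeq

/-! ### The countable case. -/

/-- Nonempty finite paths inside `X` starting at `a` and ending in `A`, as lists of vertices. -/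
structure IsFinitePath (G : SimpleGraph V) (X A : Set V) (a : V) (l : List V) : Prop where
  isChain : l.IsChain G.Adj
  nodup : l.Nodup
  mem : ∀ x ∈ l, x ∈ X
  head : l.head? = some a
  last : ∃ e ∈ A, l.getLast? = some e

namespace IsFinitePath

variable {G : SimpleGraph V} {X A : Set V} {a : V} {l : List V}

/-- The path `l` has finitely many vertices, so its last point, which lies in `A`, can be joined to
`y` without touching `l` again. -/
theorem exists_extend_to (h : IsFinitePath G X A a l) (hJ : Joins G A X ℵ₀) {y : V} (hy : y ∈ A)
    (hyl : y ∉ l) : ∃ l', IsFinitePath G X A a l' ∧ l <+: l' ∧ y ∈ l' := by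
  obtain ⟨e, he, hle⟩ := h.last
  obtain ⟨t, rfl⟩ := List.getLast?_eq_some_iff.1 hle
  have hey : e ≠ y := by
    rintro rfl
    exact hyl (by simp)
  obtain ⟨p, hp, hpX, hpF⟩ := hJ e he y hy hey {x | x ∈ t ++ [e]}
    (Cardinal.lt_aleph0_iff_set_finite.2 (t ++ [e]).finite_toSet)
  obtain ⟨s, hs⟩ : ∃ s, p.support = e :: s := ⟨_, p.cons_tail_support.symm⟩
  have hsn : e ∉ s ∧ s.Nodup := by
    have := hp.support_nodup
    rwa [hs, List.nodup_cons] at this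
  have hys : y ∈ s := by
    have := p.end_mem_support
    rw [hs, List.mem_cons] at this
    exact this.resolve_left hey.symm
  refine ⟨t ++ [e] ++ s, ⟨?_, ?_, ?_, ?_, y, hy, ?_⟩, List.prefix_append _ _,
    List.mem_append_right _ hys⟩
  · refine List.IsChain.append_overlap h.isChain ?_ (by simp)
    have := p.isChain_adj_support
    rwa [hs] at this
  · refine List.Nodup.append h.nodup hsn.2 fun z hz hzs => ?_
    rcases hpF z (by rw [hs]; exact List.mem_cons_of_mem _ hzs) hz with rfl | rfl
    · exact hsn.1 hzs
    · exact hyl hz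
  · intro x hx
    rcases List.mem_append.1 hx with hx | hx
    · exact h.mem x hx
    · exact hpX x (by rw [hs]; exact List.mem_cons_of_mem _ hx)
  · rw [List.head?_append, h.head]
    rfl
  · have h1 : p.support.getLast? = some y := by
      rw [List.getLast?_eq_some_getLast p.support_ne_nil, p.getLast_support]
    have h2 : s ≠ [] := List.ne_nil_of_mem hys
    rw [hs, List.getLast?_cons_of_ne_nil h2] at h1
    rw [List.getLast?_append, h1]
    rfl

/-- If `x` is already on `l`, another point of `A` is appended, so that the length grows at every
step and the union of the extensions is infinite. -/
theorem exists_extend (h : IsFinitePath G X A a l) (hJ : Joins G A X ℵ₀) (hA : A.Infinite) {x : V}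
    (hx : x ∈ A) :
    ∃ l', IsFinitePath G X A a l' ∧ l <+: l' ∧ l.length < l'.length ∧ x ∈ l' := by
  have hlen : ∀ {l' y}, l <+: l' → y ∈ l' → y ∉ l → l.length < l'.length := fun h1 h2 h3 =>
    lt_of_le_of_ne h1.length_le fun h4 => h3 (h1.eq_of_length h4 ▸ h2)
  by_cases hxl : x ∈ l
  · obtain ⟨y, hy, hyl⟩ := (hA.sdiff l.finite_toSet).nonempty
    obtain ⟨l', h1, h2, h3⟩ := h.exists_extend_to hJ hy hyl
    exact ⟨l', h1, h2, hlen h2 h3 hyl, h2.subset hxl⟩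
  · obtain ⟨l', h1, h2, h3⟩ := h.exists_extend_to hJ hx hxl
    exact ⟨l', h1, h2, hlen h2 h3 hxl, h3⟩

end IsFinitePath

theorem exists_nat_path {G : SimpleGraph V} {X A : Set V} (hAX : A ⊆ X) (hJ : Joins G A X ℵ₀)
    (hA : A.Infinite) {a : V} (ha : a ∈ A) (α : ℕ → V) (hα : ∀ n, α n ∈ A) :
    ∃ q : ℕ → V, Function.Injective q ∧ (∀ n, G.Adj (q n) (q (n + 1))) ∧ (∀ n, q n ∈ X) ∧
      q 0 = a ∧ ∀ n, ∃ m, q m = α n := by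
  have hstep : ∀ (l : {l // IsFinitePath G X A a l}) (n : ℕ), ∃ l' : {l // IsFinitePath G X A a l},
      l.1 <+: l'.1 ∧ l.1.length < l'.1.length ∧ α n ∈ l'.1 := fun l n => by
    obtain ⟨l', h1, h2⟩ := l.2.exists_extend hJ hA (hα n)
    exact ⟨⟨l', h1⟩, h2⟩
  choose s hs using hstep
  let L : ℕ → {l // IsFinitePath G X A a l} := fun n => Nat.rec
    ⟨[a], by simp, by simp, by simpa using hAX ha, by simp, a, ha, by simp⟩ (fun n l => s l n) n
  have hL : ∀ n, (L n).1 <+: (L (n + 1)).1 ∧ (L n).1.length < (L (n + 1)).1.length ∧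
      α n ∈ (L (n + 1)).1 := fun n => hs (L n) n
  have hpre : ∀ m n, m ≤ n → (L m).1 <+: (L n).1 := fun m n hmn => by
    induction n, hmn using Nat.le_induction with
    | base => exact List.prefix_rfl
    | succ n _ ih => exact ih.trans (hL n).1
  have hlen : ∀ n, n < (L n).1.length := fun n => by
    induction n with
    | zero => simp [L]
    | succ n ih => exact (Nat.succ_le_of_lt ih).trans_lt (hL n).2.1
  let q : ℕ → V := fun n => (L n).1[n]'(hlen n)
  have hq : ∀ m n (h : n < (L m).1.length), (L m).1[n] = q n := fun m n h => by
    rcases le_total m n with hmn | hmn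
    · exact (hpre m n hmn).getElem h
    · exact ((hpre n m hmn).getElem (hlen n)).symm
  refine ⟨q, fun m n he => ?_, fun n => ?_, fun n => (L n).2.mem _ (List.getElem_mem _), ?_,
    fun n => ?_⟩
  · wlog hmn : m ≤ n generalizing m n
    · exact (this n m he.symm (le_of_not_ge hmn)).symm
    have hm : m < (L n).1.length := (hlen m).trans_le (hpre m n hmn).length_le
    rw [← hq n m hm] at he
    exact (L n).2.nodup.getElem_inj_iff.1 he
  · have h1 : n + 1 < (L (n + 1)).1.length := hlen (n + 1)
    rw [← hq (n + 1) n (by omega)]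
    exact List.isChain_iff_getElem.1 (L (n + 1)).2.isChain n h1
  · rfl
  · obtain ⟨m, hm, he⟩ := List.getElem_of_mem (hL n).2.2
    exact ⟨m, by rw [← hq (n + 1) m hm, he]⟩

/-- Below `ω` there are no limit positions, so concentration is automatic; and an infinite `C` that
is covered is cofinal, since only finitely many points precede any position. -/
theorem reroutable_aleph0 : Reroutable V ℵ₀ := by
  intro G X A hAX hAc hJ p hp hpX a ha C hCA hC
  rw [ord_aleph0, cof_omega0] at hC
  have hCinf : C.Infinite := by
    rw [← Set.infinite_coe_iff, Cardinal.infinite_iff, hC]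
  obtain ⟨α, hα, hsurj⟩ := exists_surjOn_Iio_ord hAc a ha
  rw [ord_aleph0] at hsurj ⊢
  obtain ⟨q, hinj, hadj, hqX, h0, hcov⟩ :=
    exists_nat_path hAX hJ (hCinf.mono hCA) ha (fun n => α n) fun n => hα n
  let Q : Ordinal.{u} → V := fun ξ => q (Cardinal.toNat ξ.card)
  have hQ : ∀ n : ℕ, Q n = q n := fun n => by simp [Q]
  have hcov' : ∀ x ∈ A, ∃ n, q n = x := fun x hx => by
    obtain ⟨i, hi, rfl⟩ := hsurj x hx
    obtain ⟨n, rfl⟩ := lt_omega0.1 hi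
    exact hcov n
  refine ⟨Q, ⟨?_, ?_⟩, fun ξ _ => hqX _, fun x hx => ?_, ?_, ?_⟩
  · intro ξ hξ η hη he
    obtain ⟨m, rfl⟩ := lt_omega0.1 hξ
    obtain ⟨n, rfl⟩ := lt_omega0.1 hη
    rw [hQ, hQ] at he
    rw [hinj he]
  · intro η hη ξ hξ
    obtain ⟨n, rfl⟩ := lt_omega0.1 hη
    obtain ⟨m, rfl⟩ := lt_omega0.1 (hξ.trans hη)
    have hmn : m < n := by exact_mod_cast hξ
    obtain ⟨n, rfl⟩ : ∃ k, n = k + 1 := ⟨n - 1, by omega⟩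
    refine ⟨n, ?_, ?_, ?_, Or.inr (by push_cast; rfl)⟩
    · exact_mod_cast Nat.le_of_lt_succ hmn
    · exact_mod_cast Nat.lt_succ_self n
    · rw [hQ, hQ]
      exact (hadj n).symm
  · obtain ⟨n, hn⟩ := hcov' x hx
    exact ⟨n, natCast_lt_omega0 n, by rw [hQ, hn]⟩
  · have := hQ 0
    rw [Nat.cast_zero] at this
    rw [this, h0]
  · intro ξ hξ
    obtain ⟨n, rfl⟩ := lt_omega0.1 hξ
    obtain ⟨c, hc, hcn⟩ := (hCinf.sdiff ((Set.finite_Iio n).image q)).nonempty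
    obtain ⟨m, rfl⟩ := hcov' c (hCA hc)
    refine ⟨m, ?_, natCast_lt_omega0 m, by rwa [hQ]⟩
    have : n ≤ m := by
      by_contra! h
      exact hcn ⟨m, h, rfl⟩
    exact_mod_cast this

/-! ### One step of the construction: a new layer and its block. -/

/-- Used to count the neighbours in `A` of a limit vertex, and to bound `height`. -/
theorem cof_le_mk_of_injOn {o : Ordinal.{u}} {f : Ordinal.{u} → V} (hf : InjOn f (Iio o))
    {C : Set V} (h : ∀ ξ < o, ∃ ζ, ξ ≤ ζ ∧ ζ < o ∧ f ζ ∈ C) : o.cof ≤ #C := by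
  have h1 : IsCofinal {x : o.ToType | f x.toOrd ∈ C} := by
    intro x
    obtain ⟨ζ, h2, h3, h4⟩ := h x.toOrd x.toOrd.2
    refine ⟨ToType.mk ⟨ζ, h3⟩, by simpa using h4, ?_⟩
    exact (OrderIso.symm_apply_le _).1 h2
  have h2 := Order.cof_le h1
  rw [cof_toType] at h2
  refine h2.trans (Cardinal.mk_le_of_injective (f := fun x => (⟨f x.1.toOrd, x.2⟩ : C)) ?_)
  intro x y he
  have h3 := hf x.1.toOrd.2 y.1.toOrd.2 (congrArg Subtype.val he)
  exact Subtype.ext (ToType.mk.symm.injective (Subtype.ext h3))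

/-- From every point `p σ` a finite stretch of `p` leads to `A`. -/
theorem IsSeq.exists_tail {G : SimpleGraph V} {A : Set V} {κ : Cardinal.{u}} (hκ : ℵ₀ < κ)
    {p : Ordinal.{u} → V} (hp : IsSeq G A κ.ord p) {σ : Ordinal.{u}} (hσ : σ < κ.ord) :
    ∃ (l : List V) (b : V), (l ++ [b]).IsChain G.Adj ∧ (l ++ [b]).Nodup ∧ l.headD b = p σ ∧ b ∈ A ∧
      ∀ x ∈ l ++ [b], ∃ n : ℕ, x = p (σ + n) := by
  have hω : σ + ω < κ.ord :=
    isPrincipal_add_ord hκ.le hσ (by rwa [Cardinal.lt_ord, card_omega0])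
  have hlt : ∀ n : ℕ, σ + n < κ.ord := fun n =>
    (add_lt_add_right (natCast_lt_omega0 n) σ).trans hω
  obtain ⟨n, hn⟩ := hp.exists_add_nat_mem hω
  have he : (List.range n).map (fun m : ℕ => p (σ + m)) ++ [p (σ + n)] =
      (List.range (n + 1)).map fun m : ℕ => p (σ + m) := by
    rw [List.range_succ, List.map_append]
    rfl
  refine ⟨(List.range n).map fun m : ℕ => p (σ + m), p (σ + n), ?_, ?_, ?_, hn, ?_⟩
  · rw [he, List.isChain_iff_getElem]
    intro i hi
    have := hp.adj_add_one (η := σ + i) (by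
      have := hlt (i + 1)
      push_cast at this
      rwa [← add_assoc] at this)
    simpa [add_assoc] using this
  · rw [he]
    refine List.Nodup.map_on (fun i _ j _ hij => ?_) List.nodup_range
    exact_mod_cast add_left_cancel (hp.injOn (hlt i) (hlt j) hij)
  · cases n with
    | zero => simp
    | succ n => simp [List.range_succ_eq_map]
  · intro x hx
    rw [he] at hx
    obtain ⟨m, -, rfl⟩ := List.mem_map.1 hx
    exact ⟨m, rfl⟩

/-- An intermediate stage: the set `M` of fewer than `κ` vertices has been dealt with, and the
finite path `l ++ [b]` outside `M`, ending in `A`, is to be used next. -/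
structure IsStage (G : SimpleGraph V) (X A : Set V) (κ : Cardinal.{u}) (M : Set V) (l : List V)
    (b : V) : Prop where
  subset : M ⊆ X
  mk_lt : #M < κ
  isChain : (l ++ [b]).IsChain G.Adj
  nodup : (l ++ [b]).Nodup
  mem : ∀ x ∈ l ++ [b], x ∈ X ∧ x ∉ M
  last : b ∈ A

/-- The sequence `q` of length `o` fills `D`: it starts with `s`, covers `A ∩ D`, and its
neighbours of `s'` in `A` are cofinal. -/
structure IsBlock (G : SimpleGraph V) (A D : Set V) (s s' : V) (o : Ordinal.{u})
    (q : Ordinal.{u} → V) : Prop where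
  pos : 0 < o
  isSeq : IsSeq G A o q
  mem : ∀ ξ < o, q ξ ∈ D
  cover : ∀ x ∈ A, x ∈ D → ∃ ξ < o, q ξ = x
  first : q 0 = s
  cofinal : ∀ ξ < o, ∃ η, ξ ≤ η ∧ η < o ∧ q η ∈ A ∧ G.Adj s' (q η)

/-- The stage `(M', l', b')` extends the stage `(M, l, b)`, covers `Z` and avoids `R`. -/
structure IsStep (G : SimpleGraph V) (X A : Set V) (κ : Cardinal.{u}) (M : Set V) (l : List V)
    (b : V) (Z R M' : Set V) (l' : List V) (b' : V) : Prop where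
  subset : M ⊆ M'
  cover : Z ⊆ M'
  mem : ∀ x ∈ l ++ [b], x ∈ M'
  isStage : IsStage G X A κ M' l' b'
  avoid : ∀ x ∈ M', x ∈ R → x ∈ M ∨ x ∈ Z ∨ x ∈ l ++ [b]
  avoid_tail : ∀ x ∈ l' ++ [b'], x ∉ R
  exists_block : ∃ o q, IsBlock G A (M' \ M) (l.headD b) (l'.headD b') o q

theorem IsStage.exists_step {G : SimpleGraph V} {X A : Set V} {κ : Cardinal.{u}} (hκ : ℵ₀ < κ)
    (ih : ∀ μ < κ, ℵ₀ ≤ μ → Reroutable V μ) (hJ : Joins G A X κ)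
    {p : Ordinal.{u} → V} (hp : IsSeq G A κ.ord p) (hpX : ∀ ξ < κ.ord, p ξ ∈ X)
    {M : Set V} {l : List V} {b : V} (h : IsStage G X A κ M l b) {Z R : Set V} (hZX : Z ⊆ X)
    (hZ : #Z < κ) (hR : #R < κ) : ∃ M' l' b', IsStep G X A κ M l b Z R M' l' b' := by
  obtain ⟨μ, hμ, hμκ, hZμ⟩ : ∃ μ, ℵ₀ ≤ μ ∧ μ < κ ∧ #Z ≤ μ :=
    ⟨max ℵ₀ #Z, le_max_left _ _, max_lt hκ hZ, le_max_right _ _⟩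
  have hT : #{x | x ∈ l ++ [b]} < ℵ₀ :=
    Cardinal.lt_aleph0_iff_set_finite.2 (l ++ [b]).finite_toSet
  have hμo : μ.ord < κ.ord := Cardinal.ord_lt_ord.2 hμκ
  have hωμ : ω ≤ μ.ord := by rwa [← ord_aleph0, Cardinal.ord_le_ord]
  have hlim : Order.IsSuccLimit μ.ord := Cardinal.isSuccLimit_ord hμ
  have hωκ : ω < κ.ord := by rwa [Cardinal.lt_ord, card_omega0]
  -- The first `μ.ord` points of the interval are the path to be rerouted; the next `ω` contain the
  -- start of the next block and a finite tail from it into `A`.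
  obtain ⟨ρ, hρ, hρB⟩ := IsSeq.exists_interval hκ.le hp.injOn
    (mk_union_lt hκ.le (mk_union_lt hκ.le h.mk_lt hZ) (mk_union_lt hκ.le hR (hT.trans hκ)))
    (isPrincipal_add_ord hκ.le hμo hωκ)
  have hρlt : ∀ ξ < μ.ord + ω, ρ + ξ < κ.ord := fun ξ hξ => (add_lt_add_right hξ ρ).trans hρ
  have hμlt : ∀ ξ < μ.ord, ξ < μ.ord + ω := fun ξ hξ => hξ.trans_le le_self_add
  have hnlt : ∀ n : ℕ, μ.ord + n < μ.ord + ω := fun n => add_lt_add_right (natCast_lt_omega0 n) _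
  have hσ : ρ + μ.ord < κ.ord := by simpa using hρlt (μ.ord + (0 : ℕ)) (hnlt 0)
  obtain ⟨l', b', hc', hn', hs', hb', ht'⟩ := hp.exists_tail hκ hσ
  have ht : ∀ x ∈ l' ++ [b'], ∃ n : ℕ, x = p (ρ + (μ.ord + n)) := fun x hx => by
    obtain ⟨n, hn⟩ := ht' x hx
    exact ⟨n, by rw [hn, add_assoc]⟩
  have hT' : #{x | x ∈ l' ++ [b']} < ℵ₀ :=
    Cardinal.lt_aleph0_iff_set_finite.2 (l' ++ [b']).finite_toSet
  have hSX : (fun ξ => p (ρ + ξ)) '' Iio μ.ord ⊆ X := by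
    rintro _ ⟨ξ, hξ, rfl⟩
    exact hpX _ (hρlt ξ (hμlt ξ hξ))
  -- The new tail is added to the forbidden set, so it stays free for the next step.
  obtain ⟨D, hDX, hDM, hDμ, hZD, hDR, hDJ⟩ := hJ.exists_closure hμ hμκ (M := M)
    (Z := (Z ∪ {x | x ∈ l ++ [b]}) ∪ (fun ξ => p (ρ + ξ)) '' Iio μ.ord)
    (R := R ∪ {x | x ∈ l' ++ [b']}) h.mk_lt (mk_union_lt hκ.le hR (hT'.trans hκ))
    (mk_union_le_of_le hμ (mk_union_le_of_le hμ hZμ (hT.le.trans hμ))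
      ((mk_image_Iio_le _ _).trans (card_ord μ).le))
    (union_subset (union_subset hZX fun x hx => (h.mem x hx).1) hSX)
  have hD : ∀ x ∈ M ∪ D, x ∉ M → x ∈ D := fun x hx hxM => hx.resolve_left hxM
  have hlD : ∀ x ∈ l ++ [b], x ∈ D := fun x hx => hZD ⟨Or.inl (Or.inr hx), (h.mem x hx).2⟩
  have hpD : ∀ ξ < μ.ord, p (ρ + ξ) ∈ D := fun ξ hξ =>
    hZD ⟨Or.inr ⟨ξ, hξ, rfl⟩, fun hM => hρB ξ (hμlt ξ hξ) (Or.inl (Or.inl hM))⟩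
  have htM : ∀ x ∈ l' ++ [b'], x ∉ M ∪ D := by
    intro x hx hxMD
    obtain ⟨n, rfl⟩ := ht x hx
    rcases hxMD with hxM | hxD
    · exact hρB _ (hnlt n) (Or.inl (Or.inl hxM))
    · rcases hDR _ hxD (Or.inr hx) with (h1 | h1) | ⟨ξ, hξ, h1⟩
      · exact hρB _ (hnlt n) (Or.inl (Or.inr h1))
      · exact hρB _ (hnlt n) (Or.inr (Or.inr h1))
      · have h2 := add_left_cancel (hp.injOn (hρlt ξ (hμlt ξ hξ)) (hρlt _ (hnlt n)) h1)
        rw [h2] at hξ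
        exact (mem_Iio.1 hξ).not_ge le_self_add
  refine ⟨M ∪ D, l', b', subset_union_left, fun x hx => ?_, fun x hx => Or.inr (hlD x hx),
    ⟨union_subset h.subset hDX, mk_union_lt hκ.le h.mk_lt (hDμ.trans_lt hμκ), hc', hn',
      fun x hx => ⟨?_, htM x hx⟩, hb'⟩, fun x hx hxR => ?_, fun x hx hxR => ?_, ?_⟩
  · by_cases hxM : x ∈ M
    · exact Or.inl hxM
    · exact Or.inr (hZD ⟨Or.inl (Or.inl hx), hxM⟩)
  · obtain ⟨n, rfl⟩ := ht x hx
    exact hpX _ (hρlt _ (hnlt n))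
  · rcases hx with hx | hx
    · exact Or.inl hx
    · rcases hDR x hx (Or.inl hxR) with (h1 | h1) | ⟨ξ, hξ, rfl⟩
      · exact Or.inr (Or.inl h1)
      · exact Or.inr (Or.inr h1)
      · exact absurd (Or.inr (Or.inl hxR)) (hρB ξ (hμlt ξ hξ))
  · obtain ⟨n, rfl⟩ := ht x hx
    exact hρB _ (hnlt n) (Or.inr (Or.inl hxR))
  -- the block is obtained from the inductive hypothesis, applied to `D` without `l`
  have hbl : b ∉ l := fun hb => (List.nodup_append.1 h.nodup).2.2 b hb b (by simp) rfl
  have hpl : ∀ ξ < μ.ord, p (ρ + ξ) ∉ {x | x ∈ l} := fun ξ hξ hx =>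
    hρB ξ (hμlt ξ hξ) (Or.inr (Or.inr (List.mem_append_left _ hx)))
  have hinj : InjOn (fun ξ => p (ρ + ξ)) (Iio μ.ord) := fun ξ hξ η hη he =>
    add_left_cancel (hp.injOn (hρlt ξ (hμlt ξ hξ)) (hρlt η (hμlt η hη)) he)
  -- The limit vertex `p (ρ + μ.ord)` has neighbours in `A` cofinal in the segment. Any `cf μ` of
  -- them will do as `C`, whatever their order in `p`, because rerouting makes `C` cofinal.
  have hcof : μ.ord.cof ≤ #{x | x ∈ (A ∩ D) \ {x | x ∈ l} ∧ G.Adj (p (ρ + μ.ord)) x} := by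
    refine cof_le_mk_of_injOn hinj fun ξ hξ => ?_
    obtain ⟨ζ, h1, h2, h3, h4⟩ := hp.exists_adj_of_isSuccLimit hσ
      (Ordinal.isSuccLimit_add ρ hlim) (add_lt_add_right hξ ρ)
    have hζ : ρ + (ζ - ρ) = ζ := Ordinal.add_sub_cancel_of_le (le_self_add.trans h1)
    rw [← hζ] at h1 h2 h3 h4
    have h5 := lt_of_add_lt_add_left h2
    exact ⟨ζ - ρ, le_of_add_le_add_left h1, h5, ⟨⟨h4, hpD _ h5⟩, hpl _ h5⟩, h3⟩
  obtain ⟨C, hC, hCc⟩ := Cardinal.le_mk_iff_exists_subset.1 hcof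
  obtain ⟨q, hq, hqD, hqA, hq0, hqC⟩ := ih μ hμκ hμ G (D \ {x | x ∈ l}) ((A ∩ D) \ {x | x ∈ l})
    (sdiff_subset_sdiff_left inter_subset_right)
    ((Cardinal.mk_le_mk_of_subset (sdiff_subset.trans inter_subset_right)).trans hDμ)
    (hDJ.diff_finite hμ l.finite_toSet) (fun ξ => p (ρ + ξ))
    (((hp.shift ρ μ.ord (hσ.le)).inter (B := D \ {x | x ∈ l})
      fun ξ hξ => ⟨hpD ξ hξ, hpl ξ hξ⟩).mono fun x hx => ⟨⟨hx.1, hx.2.1⟩, hx.2.2⟩)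
    (fun ξ hξ => ⟨hpD ξ hξ, hpl ξ hξ⟩) b ⟨⟨h.last, hlD b (by simp)⟩, hbl⟩ C
    (fun x hx => (hC hx).1) hCc
  -- The rerouted sequence starts at `b`, which is in `A`; the start of the block need not be, and
  -- is reached by prepending `l`.
  obtain ⟨q', n, h1, h2, h3, h4, h5⟩ := (hq.mono (B := A) fun x hx => hx.1.1).exists_append hωμ hq0
    l h.isChain (List.nodup_append.1 h.nodup).1 fun x hx ξ hξ he => (hqD ξ hξ).2 (he ▸ hx)
  have hnμ : ∀ η < μ.ord, n + η < μ.ord := fun η hη => by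
    have := add_lt_add_right hη (n : Ordinal)
    rwa [natCast_add_of_omega0_le hωμ] at this
  refine ⟨μ.ord, q', omega0_pos.trans_le hωμ, h1, fun ξ hξ => ?_, fun x hxA hx => ?_, h2,
    fun ξ hξ => ?_⟩
  · have : q' ξ ∈ D := by
      rcases h4 ξ hξ with h6 | ⟨η, hη, h6⟩
      · exact hlD _ (List.mem_append_left _ h6)
      · rw [h6]
        exact (hqD η hη).1
    exact ⟨Or.inr this, hDM _ this⟩
  · by_cases hxl : x ∈ l
    · exact h5 x hxl
    · obtain ⟨ξ, hξ, rfl⟩ := hqA x ⟨⟨hxA, hD x hx.1 hx.2⟩, hxl⟩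
      exact ⟨n + ξ, hnμ ξ hξ, h3 ξ⟩
  · obtain ⟨η, h6, h7, h8⟩ := hqC ξ hξ
    refine ⟨n + η, h6.trans le_add_self, hnμ η h7, ?_⟩
    rw [h3, hs']
    exact ⟨(hC h8).1.1.1, (hC h8).2⟩

/-! ### Concatenation of blocks. -/

/-- The order induced by `pos` has type exactly `κ.ord`: at least, by the size of `Y`; at most,
since the element at place `κ.ord` would have `κ` predecessors. -/
theorem exists_enum_of_mk_lt {ι : Type*} [LinearOrder ι] [WellFoundedLT ι] {κ : Cardinal.{u}}
    {Y : Set V} {pos : V → ι} (hinj : InjOn pos Y) (hκ : κ ≤ #Y)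
    (hsmall : ∀ y ∈ Y, #{x | x ∈ Y ∧ pos x < pos y} < κ) (a : V) :
    ∃ q : Ordinal.{u} → V, (∀ ξ < κ.ord, q ξ ∈ Y) ∧ (∀ y ∈ Y, ∃ ξ < κ.ord, q ξ = y) ∧
      ∀ ξ η, ξ < η → η < κ.ord → pos (q ξ) < pos (q η) := by
  classical
  let f : Y ↪ ι := ⟨fun y => pos y, fun x y h => Subtype.ext (hinj x.2 y.2 h)⟩
  let r : Y → Y → Prop := fun x y => pos x < pos y
  have : IsWellOrder Y r := (RelEmbedding.preimage f (· < ·)).isWellOrder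
  have hseg : ∀ y : Y, (typein r y).card < κ := fun y => by
    rw [card_typein]
    refine (Cardinal.mk_le_of_injective
      (f := fun x => (⟨x.1.1, x.1.2, x.2⟩ : {x | x ∈ Y ∧ pos x < pos y.1})) ?_).trans_lt
      (hsmall y y.2)
    intro x z h
    exact Subtype.ext (Subtype.ext (Subtype.mk.inj h))
  have htype : type r = κ.ord := by
    refine le_antisymm ?_ (Cardinal.ord_le.2 (by rwa [card_type]))
    by_contra! h
    have := hseg (enum r ⟨κ.ord, h⟩)
    rw [typein_enum, card_ord] at this
    exact this.ne rfl
  have hlt : ∀ ξ < κ.ord, ξ < type r := fun ξ hξ => by rwa [htype]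
  have hq : ∀ ξ (h : ξ < κ.ord), (if h : ξ < type r then (enum r ⟨ξ, h⟩ : V) else a) =
      enum r ⟨ξ, hlt ξ h⟩ := fun ξ h => dif_pos (hlt ξ h)
  refine ⟨fun ξ => if h : ξ < type r then (enum r ⟨ξ, h⟩ : V) else a, fun ξ hξ => ?_,
    fun y hy => ?_, fun ξ η hξη hη => ?_⟩
  · dsimp only
    rw [hq ξ hξ]
    exact Subtype.coe_prop _
  · have h : typein r ⟨y, hy⟩ < κ.ord := htype ▸ typein_lt_type r _
    refine ⟨typein r ⟨y, hy⟩, h, ?_⟩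
    dsimp only
    rw [hq _ h, enum_typein]
  · dsimp only
    rw [hq ξ (hξη.trans hη), hq η hη]
    exact (enum_lt_enum (r := r)).2 hξη

/-- Consecutive blocks filling the layers of a continuous increasing chain of vertex sets
concatenate to one sequence. -/
theorem exists_isSeq_of_blocks {G : SimpleGraph V} {X A C : Set V} {κ : Cardinal.{u}}
    {θ : Ordinal.{u}} (hθ0 : 0 < θ) (hθ : ∀ i < θ, i + 1 < θ)
    {M : Ordinal.{u} → Set V} {s : Ordinal.{u} → V} {o : Ordinal.{u} → Ordinal.{u}}
    {q : Ordinal.{u} → Ordinal.{u} → V} (hM0 : M 0 = ∅) (hmono : ∀ i j, i ≤ j → j < θ → M i ⊆ M j)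
    (hMlim : ∀ i < θ, Order.IsSuccLimit i → M i = ⋃ j < i, M j) (hMκ : ∀ i < θ, #(M i) < κ)
    (hMX : ∀ i < θ, M i ⊆ X)
    (hblock : ∀ i < θ, IsBlock G A (M (i + 1) \ M i) (s i) (s (i + 1)) (o i) (q i))
    (hlim : ∀ i < θ, Order.IsSuccLimit i → ∀ j < i, ∃ w ∈ A, w ∈ M i ∧ w ∉ M j ∧ G.Adj (s i) w)
    (hA : ∀ x ∈ A, ∃ i < θ, x ∈ M i) (hAκ : κ ≤ #A) (hCA : C ⊆ A)
    (hC : ∀ i < θ, ∃ c ∈ C, c ∉ M i) :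
    ∃ q : Ordinal.{u} → V, IsSeq G A κ.ord q ∧ (∀ ξ < κ.ord, q ξ ∈ X) ∧
      (∀ x ∈ A, ∃ ξ < κ.ord, q ξ = x) ∧ q 0 = s 0 ∧
      ∀ ξ < κ.ord, ∃ η, ξ ≤ η ∧ η < κ.ord ∧ q η ∈ C := by
  classical
  have hlayer : ∀ i < θ, ∀ x ∈ M i, ∃ j < i, x ∈ M (j + 1) \ M j := by
    intro i
    induction i using Ordinal.limitRecOn with
    | zero =>
      intro _ x hx
      rw [hM0] at hx
      exact absurd hx (notMem_empty x)
    | add_one i ih =>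
      intro hi x hx
      by_cases hxi : x ∈ M i
      · obtain ⟨j, hj, h⟩ := ih ((lt_add_one i).trans hi) x hxi
        exact ⟨j, hj.trans (lt_add_one i), h⟩
      · exact ⟨i, lt_add_one i, hx, hxi⟩
    | limit i hl ih =>
      intro hi x hx
      rw [hMlim i hi hl] at hx
      obtain ⟨j, hj, hxj⟩ : ∃ j < i, x ∈ M j := by simpa using hx
      obtain ⟨k, hk, h⟩ := ih j hj (hj.trans hi) x hxj
      exact ⟨k, hk.trans hj, h⟩
  have hlayer_le : ∀ i j x, j < θ → x ∈ M (i + 1) \ M i → x ∉ M j → j ≤ i := by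
    intro i j x hj hx hxj
    by_contra! h
    exact hxj (hmono _ _ (Order.add_one_le_of_lt h) hj hx.1)
  have hlayer_eq : ∀ i j x, i < θ → j < θ → x ∈ M (i + 1) \ M i → x ∈ M (j + 1) \ M j → i = j :=
    fun i j x hi hj hx hy => le_antisymm (hlayer_le j i x hi hy hx.2) (hlayer_le i j x hj hx hy.2)
  let Y : Set V := {y | ∃ i < θ, ∃ ξ < o i, q i ξ = y}
  have hY : ∀ y ∈ Y, ∃ i ξ, i < θ ∧ ξ < o i ∧ q i ξ = y := by
    rintro y ⟨i, hi, ξ, hξ, rfl⟩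
    exact ⟨i, ξ, hi, hξ, rfl⟩
  choose! I P hI hP hIP using hY
  -- Vertices are ordered lexicographically, by block and then by place within the block.
  let pos : V → Ordinal.{u} ×ₗ Ordinal.{u} := fun y => toLex (I y, P y)
  have hmemY : ∀ i < θ, ∀ ξ < o i, q i ξ ∈ Y := fun i hi ξ hξ => ⟨i, hi, ξ, hξ, rfl⟩
  have hpos : ∀ i < θ, ∀ ξ < o i, pos (q i ξ) = toLex (i, ξ) := by
    intro i hi ξ hξ
    have hy := hmemY i hi ξ hξ
    have h1 : I (q i ξ) = i := hlayer_eq _ _ (q i ξ) (hI _ hy) hi (by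
      have := (hblock _ (hI _ hy)).mem _ (hP _ hy)
      rwa [hIP _ hy] at this) ((hblock i hi).mem ξ hξ)
    have h2 : P (q i ξ) = ξ := by
      refine (hblock i hi).isSeq.injOn ?_ hξ ?_
      · have := hP _ hy
        rwa [h1] at this
      · have := hIP _ hy
        rwa [h1] at this
    simp only [pos, h1, h2]
  have hAY : ∀ i < θ, ∀ x ∈ A, x ∈ M i → ∃ j < i, ∃ ξ < o j, q j ξ = x := by
    intro i hi x hxA hx
    obtain ⟨j, hj, hxj⟩ := hlayer i hi x hx
    exact ⟨j, hj, (hblock j (hj.trans hi)).cover x hxA hxj⟩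
  have hAY' : A ⊆ Y := fun x hx => by
    obtain ⟨i, hi, hxi⟩ := hA x hx
    obtain ⟨j, hj, ξ, hξ, rfl⟩ := hAY i hi x hx hxi
    exact hmemY j (hj.trans hi) ξ hξ
  have hinj : InjOn pos Y := by
    rintro _ ⟨i, hi, ξ, hξ, rfl⟩ _ ⟨j, hj, η, hη, rfl⟩ he
    rw [hpos i hi ξ hξ, hpos j hj η hη] at he
    obtain ⟨rfl, rfl⟩ := Prod.mk.inj (toLex.injective he)
    rfl
  obtain ⟨f, hfY, hfs, hfm⟩ := exists_enum_of_mk_lt hinj (hAκ.trans (Cardinal.mk_le_mk_of_subset hAY'))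
    (by
      rintro _ ⟨i, hi, ξ, hξ, rfl⟩
      refine mk_lt_of_subset ?_ (hMκ (i + 1) (hθ i hi))
      rintro _ ⟨⟨j, hj, η, hη, rfl⟩, hlt⟩
      rw [hpos i hi ξ hξ, hpos j hj η hη, Prod.Lex.toLex_lt_toLex] at hlt
      have hji : j ≤ i := by
        rcases hlt with h | h
        · exact h.le
        · exact h.1.le
      exact hmono (j + 1) (i + 1) (add_le_add_left hji 1) (hθ i hi) ((hblock j hj).mem η hη).1) (s 0)
  have hfm' : ∀ ξ < κ.ord, ∀ η < κ.ord, pos (f ξ) < pos (f η) → ξ < η := by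
    intro ξ hξ η hη h
    by_contra! hle
    rcases hle.eq_or_lt with rfl | hlt
    · exact h.ne rfl
    · exact (hfm η ξ hlt hξ).not_gt h
  have hfm'' : ∀ ξ < κ.ord, ∀ η < κ.ord, pos (f ξ) ≤ pos (f η) → ξ ≤ η := by
    intro ξ hξ η hη h
    by_contra! hlt
    exact (hfm η ξ hlt hξ).not_ge h
  refine ⟨f, ⟨?_, ?_⟩, fun ξ hξ => ?_, fun x hx => hfs x (hAY' hx), ?_, fun ξ hξ => ?_⟩
  · intro ξ hξ η hη he
    rcases lt_trichotomy ξ η with h | h | h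
    · exact absurd (congrArg pos he) (hfm ξ η h hη).ne
    · exact h
    · exact absurd (congrArg pos he) (hfm η ξ h hξ).ne'
  · intro η hη ξ hξη
    have hξ := hξη.trans hη
    obtain ⟨i, hi, η', hη', hfη⟩ := hfY η hη
    obtain ⟨j, hj, ξ', hξ', hfξ⟩ := hfY ξ hξ
    have hlt := hfm ξ η hξη hη
    rw [← hfη, ← hfξ, hpos i hi η' hη', hpos j hj ξ' hξ', Prod.Lex.toLex_lt_toLex] at hlt
    -- it suffices to find a suitable neighbour in terms of positions
    suffices h : ∃ k < θ, ∃ ζ' < o k, toLex (j, ξ') ≤ toLex (k, ζ') ∧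
        toLex (k, ζ') < toLex (i, η') ∧ G.Adj (q i η') (q k ζ') ∧
        (q k ζ' ∈ A ∨ k = i ∧ η' = ζ' + 1) by
      obtain ⟨k, hk, ζ', hζ', h1, h2, h3, h4⟩ := h
      obtain ⟨ζ, hζ, hfζ⟩ := hfs _ (hmemY k hk ζ' hζ')
      have hζη : ζ < η := hfm' ζ hζ η hη (by rwa [hfζ, ← hfη, hpos k hk ζ' hζ', hpos i hi η' hη'])
      refine ⟨ζ, hfm'' ξ hξ ζ hζ (by rwa [hfζ, ← hfξ, hpos k hk ζ' hζ', hpos j hj ξ' hξ']), hζη, ?_, ?_⟩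
      · rwa [hfζ, ← hfη]
      · rw [hfζ]
        refine h4.imp_right ?_
        rintro ⟨rfl, rfl⟩
        -- Otherwise `f (ζ + 1)` would lie strictly between two consecutive places of block `k`.
        by_contra hne
        have hlt' : ζ + 1 < η := lt_of_le_of_ne (Order.add_one_le_of_lt hζη) (Ne.symm hne)
        obtain ⟨m, hm, ν, hν, hfm1⟩ := hfY (ζ + 1) (hlt'.trans hη)
        have h5 := hfm ζ (ζ + 1) (lt_add_one ζ) (hlt'.trans hη)
        have h6 := hfm (ζ + 1) η hlt' hη
        rw [hfζ, ← hfm1, hpos k hk _ hζ', hpos m hm ν hν, Prod.Lex.toLex_lt_toLex] at h5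
        rw [← hfη, ← hfm1, hpos k hk _ hη', hpos m hm ν hν, Prod.Lex.toLex_lt_toLex] at h6
        dsimp only at h5 h6
        rcases h5 with h5 | ⟨rfl, h5⟩
        · rcases h6 with h6 | ⟨rfl, h6⟩
          · exact h5.not_gt h6
          · exact h5.ne rfl
        · rcases h6 with h6 | ⟨-, h6⟩
          · exact h6.ne rfl
          · exact (Order.add_one_le_of_lt h5).not_gt h6
    dsimp only at hlt
    rcases hlt with hji | ⟨rfl, hlt⟩
    · rcases eq_or_ne η' 0 with rfl | hη0
      · -- the first point of a block
        have hadj : ∃ k < i, ∃ ζ' < o k, toLex (j, ξ') ≤ toLex (k, ζ') ∧ q k ζ' ∈ A ∧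
            G.Adj (s i) (q k ζ') := by
          rcases Ordinal.zero_or_succ_or_isSuccLimit i with rfl | ⟨k, hki⟩ | hl
          · exact absurd hji (by simp)
          · obtain rfl : k + 1 = i := hki
            have hk : k < k + 1 := lt_add_one k
            rcases (Order.lt_add_one_iff.1 hji).eq_or_lt with rfl | hjk
            · obtain ⟨ζ, h1, h2, h3, h4⟩ := (hblock j hj).cofinal ξ' hξ'
              exact ⟨j, hk, ζ, h2, Prod.Lex.toLex_le_toLex.2 (Or.inr ⟨rfl, h1⟩), h3, h4⟩
            · obtain ⟨ζ, h1, h2, h3, h4⟩ :=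
                (hblock k (hk.trans hi)).cofinal 0 (hblock k (hk.trans hi)).pos
              exact ⟨k, hk, ζ, h2, Prod.Lex.toLex_le_toLex.2 (Or.inl hjk), h3, h4⟩
          -- A neighbour outside `M (j + 1)` belongs to a layer after `j`, hence comes after `(j,
          -- ξ')`.
          · obtain ⟨w, hwA, hwi, hwj, hadj⟩ := hlim i hi hl (j + 1) (hl.add_one_lt hji)
            obtain ⟨k, hk, ζ, hζ, rfl⟩ := hAY i hi w hwA hwi
            refine ⟨k, hk, ζ, hζ, Prod.Lex.toLex_le_toLex.2 (Or.inl ?_), hwA, hadj⟩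
            exact Order.add_one_le_iff.1
              (hlayer_le k (j + 1) _ (hθ j hj) ((hblock k (hk.trans hi)).mem ζ hζ) hwj)
        obtain ⟨k, hk, ζ, hζ, h1, h2, h3⟩ := hadj
        refine ⟨k, hk.trans hi, ζ, hζ, h1, Prod.Lex.toLex_lt_toLex.2 (Or.inl hk), ?_, Or.inl h2⟩
        rwa [(hblock i hi).first]
      · obtain ⟨ζ, -, h1, h2, h3⟩ := (hblock i hi).isSeq.adj η' hη' 0 (pos_iff_ne_zero.2 hη0)
        exact ⟨i, hi, ζ, h1.trans hη', Prod.Lex.toLex_le_toLex.2 (Or.inl hji),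
          Prod.Lex.toLex_lt_toLex.2 (Or.inr ⟨rfl, h1⟩), h2, h3.imp_right fun h => ⟨rfl, h⟩⟩
    · obtain ⟨ζ, h0, h1, h2, h3⟩ := (hblock j hi).isSeq.adj η' hη' ξ' hlt
      exact ⟨j, hi, ζ, h1.trans hη', Prod.Lex.toLex_le_toLex.2 (Or.inr ⟨rfl, h0⟩),
        Prod.Lex.toLex_lt_toLex.2 (Or.inr ⟨rfl, h1⟩), h2, h3.imp_right fun h => ⟨rfl, h⟩⟩
  · obtain ⟨i, hi, η, hη, h⟩ := hfY ξ hξ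
    rw [← h]
    exact hMX (i + 1) (hθ i hi) ((hblock i hi).mem η hη).1
  · have hb := hblock 0 hθ0
    obtain ⟨ξ, hξ, h⟩ := hfs _ (hmemY 0 hθ0 0 hb.pos)
    rcases eq_or_ne ξ 0 with rfl | hne
    · rw [h, hb.first]
    · have h1 := hfm 0 ξ (pos_iff_ne_zero.2 hne) hξ
      rw [h, hpos 0 hθ0 0 hb.pos, Prod.Lex.lt_iff] at h1
      simp at h1
  · obtain ⟨i, hi, η, hη, h⟩ := hfY ξ hξ
    obtain ⟨c, hc, hci⟩ := hC (i + 1) (hθ i hi)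
    obtain ⟨k, hk, hck⟩ := hA c (hCA hc)
    obtain ⟨j, hj, ζ, hζ, rfl⟩ := hAY k hk c (hCA hc) hck
    have hjθ := hj.trans hk
    obtain ⟨ν, hν, hfν⟩ := hfs _ (hmemY j hjθ ζ hζ)
    refine ⟨ν, hfm'' ξ hξ ν hν ?_, hν, by rwa [hfν]⟩
    rw [hfν, ← h, hpos i hi η hη, hpos j hjθ ζ hζ]
    refine Prod.Lex.toLex_le_toLex.2 (Or.inl ?_)
    exact Order.add_one_le_iff.1 (hlayer_le j (i + 1) _ (hθ i hi) ((hblock j hjθ).mem ζ hζ) hci)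

/-! ### Towers of stages. -/

/-- A chain of stages of length `o`: at successors it is continued by `IsStep`, covering `Z i (M i)`
and avoiding `R i (M i)`; at limits unions are taken and the tail is given by `g`. -/
structure IsTower (G : SimpleGraph V) (X A : Set V) (κ : Cardinal.{u}) (a : V)
    (Z R : Ordinal.{u} → Set V → Set V) (g : Ordinal.{u} → Set V → List V × V)
    (M : Ordinal.{u} → Set V) (t : Ordinal.{u} → List V × V) (o : Ordinal.{u}) : Prop where
  zero : M 0 = ∅
  tail_zero : t 0 = ([], a)
  limit : ∀ i, Order.IsSuccLimit i → M i = ⋃ j < i, M j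
  tail_limit : ∀ i, Order.IsSuccLimit i → t i = g i (M i)
  isStage : ∀ i < o, IsStage G X A κ (M i) (t i).1 (t i).2
  isStep : ∀ i < o, IsStep G X A κ (M i) (t i).1 (t i).2 (Z i (M i)) (R i (M i)) (M (i + 1))
    (t (i + 1)).1 (t (i + 1)).2

namespace IsTower

variable {G : SimpleGraph V} {X A : Set V} {κ : Cardinal.{u}} {a : V}
  {Z R : Ordinal.{u} → Set V → Set V} {g : Ordinal.{u} → Set V → List V × V}
  {M : Ordinal.{u} → Set V} {t : Ordinal.{u} → List V × V} {o : Ordinal.{u}}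

theorem mono (h : IsTower G X A κ a Z R g M t o) {j k : Ordinal.{u}} (hjk : j ≤ k) (hk : k ≤ o) :
    M j ⊆ M k := by
  induction k using Ordinal.limitRecOn with
  | zero => rw [nonpos_iff_eq_zero.1 hjk]
  | add_one k ih =>
    have hk' : k < o := (lt_add_one k).trans_le hk
    rcases hjk.eq_or_lt with rfl | hlt
    · exact Subset.rfl
    · exact (ih (Order.lt_add_one_iff.1 hlt) hk'.le).trans (h.isStep k hk').subset
  | limit k hl ih =>
    rcases hjk.eq_or_lt with rfl | hlt
    · exact Subset.rfl
    · rw [h.limit k hl]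
      exact subset_biUnion_of_mem (u := M) hlt

theorem subset_of_lt (h : IsTower G X A κ a Z R g M t o) {i j : Ordinal.{u}} (hj : j < i)
    (hi : i ≤ o) : Z j (M j) ⊆ M i :=
  (h.isStep j (hj.trans_le hi)).cover.trans (h.mono (Order.add_one_le_of_lt hj) hi)

theorem exists_mem (h : IsTower G X A κ a Z R g M t o) {i : Ordinal.{u}}
    (hl : Order.IsSuccLimit i) {x : V} (hx : x ∈ M i) : ∃ j < i, x ∈ M j := by
  rw [h.limit i hl] at hx
  simpa using hx

end IsTower

/-- The recursion takes a legal successor when one exists and stalls otherwise, so legality can be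
proved afterwards by induction. -/
theorem exists_ordinal_recursion {α : Type*} (x₀ : α) (S : Ordinal.{u} → α → α → Prop)
    (lim : (i : Ordinal.{u}) → ((j : Ordinal.{u}) → j < i → α) → α) :
    ∃ f : Ordinal.{u} → α, f 0 = x₀ ∧ (∀ i, (∃ y, S i (f i) y) → S i (f i) (f (i + 1))) ∧
      ∀ i, Order.IsSuccLimit i → f i = lim i fun j _ => f j := by
  classical
  have hs : ∀ i x, ∃ y, (∃ y, S i x y) → S i x y := fun i x => by
    by_cases h : ∃ y, S i x y
    · obtain ⟨y, hy⟩ := h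
      exact ⟨y, fun _ => hy⟩
    · exact ⟨x, fun h' => absurd h' h⟩
  choose s hs using hs
  let f : Ordinal.{u} → α := fun i => Ordinal.limitRecOn (motive := fun _ => α) i x₀
    (fun i x => s i x) fun i _ f => lim i f
  refine ⟨f, limitRecOn_zero .., fun i h => ?_, fun i h => limitRecOn_limit (h := h) ..⟩
  have : f (i + 1) = s i (f i) := limitRecOn_add_one ..
  rw [this]
  exact hs i (f i) h

/-- Unions at limits stay smaller than `κ` because the length is `cf κ`. The hypothesis `hg` is
given the tower below the limit, so a prescribed tail can be shown to be still unused. -/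
theorem exists_isTower {G : SimpleGraph V} {X A : Set V} {κ : Cardinal.{u}} (hκ : ℵ₀ < κ)
    (ih : ∀ μ < κ, ℵ₀ ≤ μ → Reroutable V μ) (hJ : Joins G A X κ)
    {p : Ordinal.{u} → V} (hp : IsSeq G A κ.ord p) (hpX : ∀ ξ < κ.ord, p ξ ∈ X) {a : V}
    (ha : a ∈ A) (haX : a ∈ X) {Z R : Ordinal.{u} → Set V → Set V}
    {g : Ordinal.{u} → Set V → List V × V}
    (hZ : ∀ i < κ.ord.cof.ord, ∀ M : Set V, #M < κ → Z i M ⊆ X ∧ #(Z i M) < κ ∧ #(R i M) < κ)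
    (hg : ∀ M t, ∀ i < κ.ord.cof.ord, Order.IsSuccLimit i → IsTower G X A κ a Z R g M t i →
      M i ⊆ X → #(M i) < κ → IsStage G X A κ (M i) (g i (M i)).1 (g i (M i)).2) :
    ∃ M t, IsTower G X A κ a Z R g M t κ.ord.cof.ord := by
  obtain ⟨f, h0, hsucc, hlim⟩ := exists_ordinal_recursion
    ((∅, [], a) : Set V × List V × V)
    (fun i x y => IsStep G X A κ x.1 x.2.1 x.2.2 (Z i x.1) (R i x.1) y.1 y.2.1 y.2.2)
    (fun i f => (⋃ j, ⋃ h : j < i, (f j h).1, g i (⋃ j, ⋃ h : j < i, (f j h).1)))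
  have hM : ∀ i, Order.IsSuccLimit i → (f i).1 = ⋃ j < i, (f j).1 := fun i hi => by rw [hlim i hi]
  have ht : ∀ i, Order.IsSuccLimit i → (f i).2 = g i (f i).1 := fun i hi => by rw [hlim i hi]
  have hstep : ∀ i < κ.ord.cof.ord, IsStage G X A κ (f i).1 (f i).2.1 (f i).2.2 →
      IsStep G X A κ (f i).1 (f i).2.1 (f i).2.2 (Z i (f i).1) (R i (f i).1) (f (i + 1)).1
        (f (i + 1)).2.1 (f (i + 1)).2.2 := by
    intro i hi h
    obtain ⟨h1, h2, h3⟩ := hZ i hi _ h.mk_lt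
    obtain ⟨M', l', b', h4⟩ := h.exists_step hκ ih hJ hp hpX h1 h2 h3
    exact hsucc i ⟨(M', l', b'), h4⟩
  have hstage : ∀ i < κ.ord.cof.ord, IsStage G X A κ (f i).1 (f i).2.1 (f i).2.2 := by
    intro i
    induction i using WellFoundedLT.induction with
    | ind i ih =>
      intro hi
      rcases Ordinal.zero_or_succ_or_isSuccLimit i with rfl | ⟨k, hki⟩ | hl
      · rw [h0]
        exact ⟨empty_subset X, by simpa using aleph0_pos.trans hκ, by simp, by simp,
          by simpa using haX, ha⟩
      · obtain rfl : k + 1 = i := hki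
        have hk := (lt_add_one k).trans hi
        exact (hstep k hk (ih k (lt_add_one k) hk)).isStage
      · have := hg (fun i => (f i).1) (fun i => (f i).2) i hi hl
          ⟨by simp only [h0], by simp only [h0], hM, ht, fun j hj => ih j hj (hj.trans hi),
            fun j hj => hstep j (hj.trans hi) (ih j hj (hj.trans hi))⟩ ?_ ?_
        · rw [ht i hl]
          exact this
        · rw [hM i hl]
          exact iUnion₂_subset fun j hj => (ih j hj (hj.trans hi)).subset
        · rw [hM i hl]
          exact mk_biUnion_Iio_lt hκ.le hi fun j hj => (ih j hj (hj.trans hi)).mk_lt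
  exact ⟨fun i => (f i).1, fun i => (f i).2, by simp only [h0], by simp only [h0], hM, ht, hstage,
    fun i hi => hstep i hi (hstage i hi)⟩

theorem IsTower.exists_isSeq {G : SimpleGraph V} {X A C : Set V} {κ : Cardinal.{u}} (hκ : ℵ₀ < κ)
    {a : V} {Z R : Ordinal.{u} → Set V → Set V} {g : Ordinal.{u} → Set V → List V × V}
    {M : Ordinal.{u} → Set V} {t : Ordinal.{u} → List V × V}
    (h : IsTower G X A κ a Z R g M t κ.ord.cof.ord)
    (hlim : ∀ i < κ.ord.cof.ord, Order.IsSuccLimit i → ∀ j < i,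
      ∃ w ∈ A, w ∈ M i ∧ w ∉ M j ∧ G.Adj ((t i).1.headD (t i).2) w)
    (hA : ∀ x ∈ A, ∃ i < κ.ord.cof.ord, x ∈ M i) (hAκ : κ ≤ #A) (hCA : C ⊆ A)
    (hC : ∀ i < κ.ord.cof.ord, ∃ c ∈ C, c ∉ M i) :
    ∃ q : Ordinal.{u} → V, IsSeq G A κ.ord q ∧ (∀ ξ < κ.ord, q ξ ∈ X) ∧
      (∀ x ∈ A, ∃ ξ < κ.ord, q ξ = x) ∧ q 0 = a ∧
      ∀ ξ < κ.ord, ∃ η, ξ ≤ η ∧ η < κ.ord ∧ q η ∈ C := by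
  have hθ : Order.IsSuccLimit κ.ord.cof.ord :=
    isSuccLimit_ord (aleph0_le_cof_iff.2 (one_lt_cof_iff.2 (isSuccLimit_ord hκ.le)))
  have : Nonempty V := ⟨a⟩
  choose! o q hb using fun i hi => (h.isStep i hi).exists_block
  have := exists_isSeq_of_blocks (s := fun i => (t i).1.headD (t i).2) hθ.pos
    (fun i hi => hθ.add_one_lt hi) h.zero (fun i j hij hj => h.mono hij hj.le)
    (fun i _ hl => h.limit i hl) (fun i hi => (h.isStage i hi).mk_lt)
    (fun i hi => (h.isStage i hi).subset) hb hlim hA hAκ hCA hC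
  simpa only [h.tail_zero, List.headD_nil] using this

/-! ### Tools for choosing the starts at limit stages. -/

theorem le_card_sdiff_singleton {C : Set V} {c : Cardinal.{u}} (hc : ℵ₀ ≤ c) (hC : c ≤ #C) (a : V) :
    c ≤ #(C \ {a} : Set V) := by
  by_contra! h
  have h1 : #({a} : Set V) < c := by
    rw [Cardinal.mk_singleton]
    exact one_lt_aleph0.trans_le hc
  have h2 := mk_lt_of_subset (A := C) (fun x hx => by
    by_cases hxa : x = a
    · exact Or.inr hxa
    · exact Or.inl ⟨hx, hxa⟩) (mk_union_lt hc h h1)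
  exact h2.not_ge hC

theorem exists_cofinal_Iio_ord_cof {o : Ordinal.{u}} (ho : Order.IsSuccLimit o) :
    ∃ f : Ordinal.{u} → Ordinal.{u}, (∀ i, f i < o) ∧ ∀ ξ < o, ∃ i < o.cof.ord, ξ < f i := by
  obtain ⟨s, hs, hsc⟩ := Order.exists_cof_eq o.ToType
  rw [cof_toType] at hsc
  obtain ⟨x, hx, -⟩ := hs (ToType.mk ⟨0, ho.pos⟩)
  obtain ⟨α, -, hα⟩ := exists_surjOn_Iio_ord hsc.le x hx
  refine ⟨fun i => (α i).toOrd + 1, fun i => ho.add_one_lt (α i).toOrd.2, fun ξ hξ => ?_⟩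
  obtain ⟨y, hy, hle⟩ := hs (ToType.mk ⟨ξ, hξ⟩)
  obtain ⟨i, hi, rfl⟩ := hα y hy
  refine ⟨i, hi, ?_⟩
  have : (⟨ξ, hξ⟩ : Iio o) ≤ (α i).toOrd := (OrderIso.le_symm_apply _).2 hle
  exact Order.lt_add_one_iff.2 this

/-- The least strict upper bound of the indices below `o` of the points of `p` that lie in `M`. -/
noncomputable def height (p : Ordinal.{u} → V) (o : Ordinal.{u}) (M : Set V) : Ordinal.{u} :=
  sInf {δ | ∀ ξ < o, p ξ ∈ M → ξ < δ}

theorem lt_height {p : Ordinal.{u} → V} {o : Ordinal.{u}} {M : Set V} {ξ : Ordinal.{u}}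
    (hξ : ξ < o) (h : p ξ ∈ M) : ξ < height p o M :=
  csInf_mem (s := {δ | ∀ ξ < o, p ξ ∈ M → ξ < δ}) ⟨o, fun _ hξ _ => hξ⟩ ξ hξ h

theorem exists_le_of_lt_height {p : Ordinal.{u} → V} {o : Ordinal.{u}} {M : Set V}
    {ξ : Ordinal.{u}} (h : ξ < height p o M) : ∃ ν < o, p ν ∈ M ∧ ξ ≤ ν := by
  by_contra! hcon
  exact h.not_ge (csInf_le' hcon)

theorem height_lt {p : Ordinal.{u} → V} {o : Ordinal.{u}} (hp : InjOn p (Iio o)) {M : Set V}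
    (hM : #M < o.cof) : height p o M < o := by
  have : ∃ δ < o, ∀ ξ < o, p ξ ∈ M → ξ < δ := by
    by_contra! h
    refine (cof_le_mk_of_injOn hp (C := M) fun ξ hξ => ?_).not_gt hM
    obtain ⟨ζ, h1, h2, h3⟩ := h ξ hξ
    exact ⟨ζ, h3, h1, h2⟩
  obtain ⟨δ, hδ, h⟩ := this
  exact (csInf_le' (s := {δ | ∀ ξ < o, p ξ ∈ M → ξ < δ}) h).trans_lt hδ

/-! ### Regular cardinals. -/

/-- By regularity each `M i` meets `p` in a bounded set of indices. At a limit stage `height p κ.ord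
(M i)` is a limit ordinal, and the vertex of `p` there starts the next block. -/
theorem reroutable_of_cof_eq {κ : Cardinal.{u}} (hκ : ℵ₀ < κ) (hreg : κ.ord.cof = κ)
    (ih : ∀ μ < κ, ℵ₀ ≤ μ → Reroutable V μ) : Reroutable V κ := by
  intro G X A hAX hAc hJ p hp hpX a ha C hCA hC
  have : Nonempty V := ⟨a⟩
  have hlimκ : Order.IsSuccLimit κ.ord := isSuccLimit_ord hκ.le
  obtain ⟨α, hα, hsurj⟩ := exists_surjOn_Iio_ord hAc a ha
  choose! l b ht using fun σ hσ => hp.exists_tail hκ (σ := σ) hσ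
  have hlt : ∀ σ < κ.ord, ∀ n : ℕ, σ + n < κ.ord := fun σ hσ n =>
    isPrincipal_add_ord hκ.le hσ ((natCast_lt_omega0 n).trans
      (by rwa [Cardinal.lt_ord, card_omega0]))
  have hδ : ∀ M : Set V, #M < κ → height p κ.ord M < κ.ord := fun M hM =>
    height_lt hp.injOn (by rwa [hreg])
  have hg : ∀ M : Set V, M ⊆ X → #M < κ →
      IsStage G X A κ M (l (height p κ.ord M)) (b (height p κ.ord M)) := by
    intro M hMX hM
    obtain ⟨h1, h2, -, h4, h5⟩ := ht _ (hδ M hM)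
    refine ⟨hMX, hM, h1, h2, fun x hx => ?_, h4⟩
    obtain ⟨n, rfl⟩ := h5 x hx
    have h6 := hlt _ (hδ M hM) n
    exact ⟨hpX _ h6, fun h => (lt_height h6 h).not_ge le_self_add⟩
  obtain ⟨M, t, hT⟩ := exists_isTower hκ ih hJ hp hpX ha (hAX ha)
    -- The `+ 1` includes the vertex at the height itself, so heights increase strictly; `α i`
    -- ensures that `A` is exhausted.
    (Z := fun i M => p '' Iio (height p κ.ord M + 1) ∪ {α i}) (R := fun _ _ => ∅)
    (g := fun _ M => (l (height p κ.ord M), b (height p κ.ord M))) (by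
      intro i hi M hM
      have h1 := hlimκ.add_one_lt (hδ M hM)
      refine ⟨union_subset ?_ (singleton_subset_iff.2 (hAX (hα i))), mk_union_lt hκ.le
        ((mk_image_Iio_le _ _).trans_lt (Cardinal.lt_ord.1 h1)) ?_, ?_⟩
      · rintro _ ⟨ξ, hξ, rfl⟩
        exact hpX ξ (lt_trans hξ h1)
      · rw [Cardinal.mk_singleton]
        exact one_lt_aleph0.trans hκ
      · simpa using aleph0_pos.trans hκ)
    fun M t i _ _ _ hMX hM => hg (M i) hMX hM
  refine hT.exists_isSeq hκ (fun i hi hl j hj => ?_) (fun x hx => ?_) (hp.le_mk hκ) hCA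
    fun i hi => ?_
  · have hδlt : ∀ k < i, height p κ.ord (M k) < height p κ.ord (M i) := fun k hk => by
      have h1 := hδ _ (hT.isStage k (hk.trans hi)).mk_lt
      exact lt_height h1 (hT.subset_of_lt hk hi.le (Or.inl ⟨_, mem_Iio.2 (lt_add_one _), rfl⟩))
    have hlow : ∀ ξ < height p κ.ord (M i), ∃ k < i, ξ < height p κ.ord (M k) := fun ξ hξ => by
      obtain ⟨ν, hν, hνi, hle⟩ := exists_le_of_lt_height hξ
      obtain ⟨k, hk, hνk⟩ := hT.exists_mem hl hνi
      exact ⟨k, hk, hle.trans_lt (lt_height hν hνk)⟩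
    have hi' := hδ _ (hT.isStage i hi).mk_lt
    have hδl : Order.IsSuccLimit (height p κ.ord (M i)) := by
      refine Ordinal.isSuccLimit_iff.2 ⟨((hδlt j hj).pos).ne',
        Order.isSuccPrelimit_of_succ_lt fun ξ hξ => ?_⟩
      obtain ⟨k, hk, h1⟩ := hlow ξ hξ
      exact (Order.succ_le_of_lt h1).trans_lt (hδlt k hk)
    -- A neighbour with index at least the height of `M j` is outside `M j`; being below the height
    -- of some `M k` with `k < i`, it has been absorbed into `M i`.
    obtain ⟨ζ, h1, h2, h3, h4⟩ := hp.exists_adj_of_isSuccLimit hi' hδl (hδlt j hj)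
    refine ⟨p ζ, h4, ?_, fun h => (lt_height (h2.trans hi') h).not_ge h1, ?_⟩
    · obtain ⟨k, hk, h5⟩ := hlow ζ h2
      exact hT.subset_of_lt hk hi.le (Or.inl ⟨ζ, h5.trans (lt_add_one _), rfl⟩)
    · rw [hT.tail_limit i hl]
      dsimp only
      rwa [(ht _ hi').2.2.1]
  · obtain ⟨i, hi, rfl⟩ := hsurj x hx
    rw [hreg]
    exact ⟨i + 1, hlimκ.add_one_lt hi,
      hT.subset_of_lt (lt_add_one i) (by rw [hreg]; exact (hlimκ.add_one_lt hi).le) (Or.inr rfl)⟩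
  · by_contra! h
    have := (Cardinal.mk_le_mk_of_subset (show C ⊆ M i from h)).trans_lt (hT.isStage i hi).mk_lt
    rw [hC, hreg] at this
    exact this.ne rfl

/-! ### Singular cardinals. -/

/-- Here `M i` may be unbounded along `p`, and could swallow all of `C`. Both dangers are met by
reserving a set `W` with a schedule `h`: stage `i` releases the points scheduled for `i` and avoids
later ones. -/
theorem reroutable_of_cof_lt {κ : Cardinal.{u}} (hκ : ℵ₀ < κ) (hsing : κ.ord.cof < κ)
    (ih : ∀ μ < κ, ℵ₀ ≤ μ → Reroutable V μ) : Reroutable V κ := by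
  classical
  intro G X A hAX hAc hJ p hp hpX a ha C hCA hC
  have : Nonempty V := ⟨a⟩
  have hlimκ : Order.IsSuccLimit κ.ord := isSuccLimit_ord hκ.le
  have hωκ : ω < κ.ord := by rwa [Cardinal.lt_ord, card_omega0]
  have hcof : ℵ₀ ≤ κ.ord.cof := aleph0_le_cof_iff.2 (one_lt_cof_iff.2 hlimκ)
  obtain ⟨α, hα, hsurj⟩ := exists_surjOn_Iio_ord hAc a ha
  obtain ⟨f, hf, hfcof⟩ := exists_cofinal_Iio_ord_cof hlimκ
  obtain ⟨c, hcinj, hc⟩ := exists_injOn_Iio_ord (le_card_sdiff_singleton hcof hC.ge a) a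
  choose! l b ht using fun σ hσ => hp.exists_tail hκ (σ := σ) hσ
  set θ := κ.ord.cof.ord with hθdef
  have hlimθ : Order.IsSuccLimit θ := isSuccLimit_ord hcof
  have hθκ : θ < κ.ord := Cardinal.ord_lt_ord.2 hsing
  have hωθ : ω * θ < κ.ord := isPrincipal_mul_ord hκ.le hωκ hθκ
  -- Each stage owns `ω` consecutive points, enough for a finite tail into `A`. Missing `C` keeps
  -- the schedule unambiguous; missing `a` leaves the first point unreserved.
  obtain ⟨ρ, hρ, hρB⟩ := IsSeq.exists_interval hκ.le hp.injOn
    (B := C ∪ {a}) (mk_union_lt hκ.le (by rwa [hC]) (by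
      rw [Cardinal.mk_singleton]
      exact one_lt_aleph0.trans hκ)) hωθ
  have hρlt : ∀ ξ < ω * θ, ρ + ξ < κ.ord := fun ξ hξ => (add_lt_add_right hξ ρ).trans hρ
  -- the reserved set, and the stage at which each of its elements is to be used
  let W : Set V := (fun ξ => p (ρ + ξ)) '' Iio (ω * θ) ∪ c '' Iio θ
  obtain ⟨h, hh1, hh2⟩ : ∃ h : V → Ordinal.{u}, (∀ ξ < ω * θ, h (p (ρ + ξ)) = ξ / ω) ∧
      ∀ k < θ, h (c k) = k := by
    refine ⟨fun x => if hx : ∃ ξ < ω * θ, p (ρ + ξ) = x then hx.choose / ω else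
      if hx : ∃ k < θ, c k = x then hx.choose else 0, fun ξ hξ => ?_, fun k hk => ?_⟩
    · have hx : ∃ ξ' < ω * θ, p (ρ + ξ') = p (ρ + ξ) := ⟨ξ, hξ, rfl⟩
      simp only [dif_pos hx]
      have h1 := hp.injOn (hρlt _ hx.choose_spec.1) (hρlt ξ hξ) hx.choose_spec.2
      rw [add_left_cancel h1]
    · have hx : ¬ ∃ ξ < ω * θ, p (ρ + ξ) = c k := by
        rintro ⟨ξ, hξ, he⟩
        exact hρB ξ hξ (Or.inl (he ▸ (hc k hk).1))
      have hx' : ∃ k' < θ, c k' = c k := ⟨k, hk, rfl⟩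
      simp only [dif_neg hx, dif_pos hx']
      exact hcinj hx'.choose_spec.1 hk hx'.choose_spec.2
  have hhW : ∀ x ∈ W, h x < θ := by
    rintro _ (⟨ξ, hξ, rfl⟩ | ⟨k, hk, rfl⟩)
    · dsimp only
      rw [hh1 ξ hξ]
      exact (lt_mul_iff_div_lt omega0_ne_zero).1 hξ
    · rwa [hh2 k hk]
  have hWX : W ⊆ X := by
    rintro _ (⟨ξ, hξ, rfl⟩ | ⟨k, hk, rfl⟩)
    · exact hpX _ (hρlt ξ hξ)
    · exact hAX (hCA (hc k hk).1)
  have hWκ : #W < κ := mk_union_lt hκ.le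
    ((mk_image_Iio_le _ _).trans_lt (Cardinal.lt_ord.1 hωθ))
    ((mk_image_Iio_le _ _).trans_lt (Cardinal.lt_ord.1 hθκ))
  have haW : a ∉ W := by
    rintro (⟨ξ, hξ, he⟩ | ⟨k, hk, he⟩)
    · exact hρB ξ hξ (Or.inr he)
    · exact (hc k hk).2 he
  have hspine : ∀ i < θ, ∀ n : ℕ, ω * i + n < ω * θ ∧ h (p (ρ + (ω * i + n))) = i := by
    intro i hi n
    have h1 : (ω * i + n) / ω = i := by
      rw [Ordinal.mul_add_div _ omega0_ne_zero, div_eq_zero_of_lt (natCast_lt_omega0 n), add_zero]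
    have h2 : ω * i + n < ω * θ := (lt_mul_iff_div_lt omega0_ne_zero).2 (by rwa [h1])
    exact ⟨h2, by rw [hh1 _ h2, h1]⟩
  have hspine0 : ∀ i < θ, ρ + ω * i < κ.ord := fun i hi => hρlt _ (by
    simpa using (hspine i hi 0).1)
  let Z : Ordinal.{u} → Set V → Set V := fun i _ =>
    (α '' Iio (f i)) \ W ∪ {x | x ∈ W ∧ h x = i}
  let R : Ordinal.{u} → Set V → Set V := fun i _ => {x | x ∈ W ∧ i < h x}
  let g : Ordinal.{u} → Set V → List V × V := fun i _ => (l (ρ + ω * i), b (ρ + ω * i))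
  have hgmem : ∀ i < θ, ∀ M, ∀ x ∈ (g i M).1 ++ [(g i M).2], x ∈ W ∧ h x = i := by
    intro i hi M x hx
    obtain ⟨n, rfl⟩ := (ht _ (hspine0 i hi)).2.2.2.2 x hx
    rw [add_assoc]
    exact ⟨Or.inl ⟨_, (hspine i hi n).1, rfl⟩, (hspine i hi n).2⟩
  have htail : ∀ M t o, o ≤ θ → IsTower G X A κ a Z R g M t o → ∀ i < o,
      ∀ x ∈ (t i).1 ++ [(t i).2], x ∈ W → h x ≤ i := by
    intro M t o ho hT i hi x hx hxW
    rcases Ordinal.zero_or_succ_or_isSuccLimit i with rfl | ⟨k, hki⟩ | hl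
    · rw [hT.tail_zero] at hx
      obtain rfl : x = a := by simpa using hx
      exact absurd hxW haW
    · obtain rfl : k + 1 = i := hki
      have h1 := (hT.isStep k ((lt_add_one k).trans hi)).avoid_tail x hx
      by_contra! h2
      exact h1 ⟨hxW, (lt_add_one k).trans h2⟩
    · rw [hT.tail_limit i hl] at hx
      exact (hgmem i (hi.trans_le ho) (M i) x hx).2.le
  -- Together with `hZmem` below, this says that `M i` contains exactly the points of `W` scheduled
  -- before `i`.
  have hlow : ∀ M t o, o ≤ θ → IsTower G X A κ a Z R g M t o → ∀ i ≤ o,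
      ∀ x ∈ M i, x ∈ W → h x < i := by
    intro M t o ho hT i
    induction i using Ordinal.limitRecOn with
    | zero =>
      intro _ x hx
      rw [hT.zero] at hx
      exact absurd hx (notMem_empty x)
    | add_one i ih =>
      intro hi x hx hxW
      have hi' : i < o := (lt_add_one i).trans_le hi
      rw [Order.lt_add_one_iff]
      by_contra! hlt
      rcases (hT.isStep i hi').avoid x hx ⟨hxW, hlt⟩ with h1 | h1 | h1
      · exact (ih hi'.le x h1 hxW).not_gt hlt
      · rcases h1 with h1 | h1
        · exact h1.2 hxW
        · exact hlt.ne h1.2.symm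
      · exact (htail M t o ho hT i hi' x h1 hxW).not_gt hlt
    | limit i hl ih =>
      intro hi x hx hxW
      obtain ⟨j, hj, hxj⟩ := hT.exists_mem hl hx
      exact (ih j hj (hj.le.trans hi) x hxj hxW).trans hj
  obtain ⟨M, t, hT⟩ := exists_isTower hκ ih hJ hp hpX ha (hAX ha) (Z := Z) (R := R) (g := g) (by
      intro i hi M hM
      refine ⟨union_subset ?_ fun x hx => hWX hx.1, mk_union_lt hκ.le
        (mk_lt_of_subset sdiff_subset ((mk_image_Iio_le _ _).trans_lt (Cardinal.lt_ord.1 (hf i))))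
        (mk_lt_of_subset (fun x hx => hx.1) hWκ), mk_lt_of_subset (fun x hx => hx.1) hWκ⟩
      rintro _ ⟨⟨ξ, -, rfl⟩, -⟩
      exact hAX (hα ξ)) (by
      intro M t i hi hl hT hMX hM
      obtain ⟨h1, h2, -, h4, -⟩ := ht _ (hspine0 i hi)
      refine ⟨hMX, hM, h1, h2, fun x hx => ?_, h4⟩
      have h5 := hgmem i hi (M i) x hx
      exact ⟨hWX h5.1, fun h6 => (hlow M t i (le_of_lt hi) hT i le_rfl x h6 h5.1).ne h5.2⟩)
  have hZmem : ∀ x ∈ W, ∀ i < θ, h x < i → x ∈ M i := fun x hx i hi hxi =>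
    hT.subset_of_lt hxi hi.le (Or.inr ⟨hx, rfl⟩)
  refine hT.exists_isSeq hκ (fun i hi hl j hj => ?_) (fun x hx => ?_) (hp.le_mk hκ) hCA
    fun i hi => ?_
  · have hl' : Order.IsSuccLimit (ρ + ω * i) :=
      Ordinal.isSuccLimit_add ρ (isSuccLimit_mul_right omega0_pos hl)
    obtain ⟨ζ, h1, h2, h3, h4⟩ := hp.exists_adj_of_isSuccLimit (hspine0 i hi) hl'
      (ξ := ρ + ω * j) (add_lt_add_right (mul_lt_mul_of_pos_left hj omega0_pos) ρ)
    have hζ : ρ + (ζ - ρ) = ζ := Ordinal.add_sub_cancel_of_le (le_self_add.trans h1)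
    rw [← hζ] at h1 h2 h3 h4
    have h5 := (mul_le_iff_le_div omega0_ne_zero).1 (le_of_add_le_add_left h1)
    have h6 := lt_of_add_lt_add_left h2
    have h7 : ζ - ρ < ω * θ := h6.trans (mul_lt_mul_of_pos_left hi omega0_pos)
    rw [← hh1 _ h7] at h5
    have hW : p (ρ + (ζ - ρ)) ∈ W := Or.inl ⟨_, h7, rfl⟩
    refine ⟨_, h4, hZmem _ hW i hi ?_,
      fun h8 => (hlow M t θ le_rfl hT j (hj.trans hi).le _ h8 hW).not_ge h5, ?_⟩
    · rw [hh1 _ h7]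
      exact (lt_mul_iff_div_lt omega0_ne_zero).1 h6
    · rw [hT.tail_limit i hl]
      dsimp only [g]
      rwa [(ht _ (hspine0 i hi)).2.2.1]
  · by_cases hxW : x ∈ W
    · have h1 := hlimθ.add_one_lt (hhW x hxW)
      exact ⟨_, h1, hZmem x hxW _ h1 (lt_add_one _)⟩
    · obtain ⟨ξ, hξ, rfl⟩ := hsurj x hx
      obtain ⟨i, hi, hξi⟩ := hfcof ξ hξ
      have h1 := hlimθ.add_one_lt hi
      exact ⟨_, h1, hT.subset_of_lt (lt_add_one i) h1.le (Or.inl ⟨⟨ξ, hξi, rfl⟩, hxW⟩)⟩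
  -- The point `c i` is scheduled for stage `i`, so it is not yet in `M i`.
  · refine ⟨c i, (hc i hi).1, fun h1 => ?_⟩
    exact (hlow M t θ le_rfl hT i (le_of_lt hi) _ h1 (Or.inr ⟨i, hi, rfl⟩)).ne (hh2 i hi)

/-! ### The induction, and translation to and from paths in graphs. -/

theorem reroutable {κ : Cardinal.{u}} (hκ : ℵ₀ ≤ κ) : Reroutable V κ := by
  induction κ using WellFoundedLT.induction with
  | ind κ ih =>
    rcases hκ.eq_or_lt with rfl | hlt
    · exact reroutable_aleph0
    · rcases (cof_ord_le κ).eq_or_lt with h | h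
      · exact reroutable_of_cof_eq hlt h ih
      · exact reroutable_of_cof_lt hlt h ih

/-- If `F` met the interior of every path in `S`, disjointness of the interiors would inject `S`
into `F`. -/
theorem IsUnseparable.joins {G : SimpleGraph V} {κ : Cardinal.{u}} {A : Set V}
    (h : IsUnseparable G κ A) : Joins G A univ κ := by
  intro v hv w hw hvw F hF
  obtain ⟨S, hS, hdis⟩ := h v hv w hw hvw
  by_contra! hcon
  have hbad : ∀ p : G.Path v w, ∃ x ∈ p.1.support, x ∈ F ∧ x ≠ v ∧ x ≠ w := fun p =>
    hcon p.1 p.2 fun x _ => mem_univ x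
  choose x hx hxF hxv hxw using hbad
  have hinj : Function.Injective fun p : S => (⟨x p.1, hxF p.1⟩ : F) := by
    intro p q he
    by_contra hne
    have he' : x p.1 = x q.1 := congrArg Subtype.val he
    rcases hdis p.2 q.2 (fun h => hne (Subtype.ext h)) (x p.1) (hx p.1) (he' ▸ hx q.1) with h | h
    · exact hxv _ h
    · exact hxw _ h
  have := Cardinal.mk_le_of_injective hinj
  rw [hS] at this
  exact this.not_gt hF

/-- A point that is neither first nor a limit has an immediate predecessor, and cofinality below it
forces adjacency to that predecessor. -/
theorem RadoPath.exists_isSeq {G : SimpleGraph V} {A : Set V} (P : RadoPath G)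
    (hP : P.ConcentratedOn A) (a : V) : ∃ p, IsSeq G A P.orderType p := by
  classical
  let e : ∀ ξ, ξ < P.orderType → P.graph.verts := fun ξ h => enum P.lt ⟨ξ, h⟩
  have he : ∀ ξ η hξ hη, P.lt (e ξ hξ) (e η hη) ↔ ξ < η := fun ξ η hξ hη =>
    enum_lt_enum (r := P.lt)
  have hsurj : ∀ x, ∃ ξ hξ, e ξ hξ = x := fun x =>
    ⟨typein P.lt x, typein_lt_type P.lt x, enum_typein P.lt x⟩
  let p : Ordinal.{u} → V := fun ξ => if h : ξ < P.orderType then e ξ h else a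
  have hp : ∀ ξ h, p ξ = e ξ h := fun ξ h => dif_pos h
  refine ⟨p, fun ξ hξ η hη h => ?_, fun η hη ξ hξη => ?_⟩
  · rw [hp ξ hξ, hp η hη] at h
    exact congrArg Subtype.val ((enum P.lt).injective (Subtype.ext h))
  · have hξ := hξη.trans hη
    have hlt := (he ξ η hξ hη).2 hξη
    by_cases hl : P.IsLimitPoint (e η hη)
    · obtain ⟨z, h1, h2, h3, h4⟩ := hP _ hl _ hlt
      obtain ⟨ζ, hζ, rfl⟩ := hsurj z
      refine ⟨ζ, ?_, (he _ _ _ _).1 h4, by rwa [hp η hη, hp ζ hζ], Or.inl (by rwa [hp ζ hζ])⟩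
      rcases h3 with h3 | h3
      · exact (congrArg Subtype.val ((enum P.lt).injective (Subtype.ext
          (congrArg Subtype.val h3)))).ge
      · exact ((he _ _ _ _).1 h3).le
    · have : ∃ x, P.lt x (e η hη) ∧ ∀ z, P.lt x z → ¬ P.lt z (e η hη) := by
        by_contra! hcon
        exact hl ⟨⟨_, hlt⟩, hcon⟩
      obtain ⟨x, hx, hmax⟩ := this
      obtain ⟨w, h1, h2, h3⟩ := P.isPathOrder.cofinal_below _ _ hx
      obtain rfl : w = x := h3.resolve_right fun h => hmax w h h2
      obtain ⟨ζ, hζ, rfl⟩ := hsurj w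
      have hζη : ζ < η := (he _ _ _ _).1 h2
      have hgap : ∀ ν, ζ < ν → ν < η → False := fun ν h4 h5 =>
        hmax (e ν (h5.trans hη)) ((he _ _ _ _).2 h4) ((he _ _ _ _).2 h5)
      refine ⟨ζ, not_lt.1 fun h => hgap ξ h hξη, hζη, ?_, Or.inr ?_⟩
      · rw [hp η hη, hp ζ hζ]
        exact P.graph.adj_sub h1
      · by_contra hne
        exact hgap (ζ + 1) (lt_add_one ζ)
          (lt_of_le_of_ne (Order.add_one_le_of_lt hζη) (Ne.symm hne))

theorem IsSeq.exists_radoPath {G : SimpleGraph V} {A : Set V} {o : Ordinal.{u}}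
    {q : Ordinal.{u} → V} (h : IsSeq G A o q) :
    ∃ Q : RadoPath G, Q.orderType = o ∧ Q.ConcentratedOn A ∧ Q.graph.verts = q '' Iio o ∧
      ∀ ξ η hξ hη, Q.lt ⟨q ξ, hξ⟩ ⟨q η, hη⟩ → ξ < o → η < o → ξ < η := by
  classical
  let Y : Set V := q '' Iio o
  -- Extra edges do no harm to a path order, so the whole induced subgraph can be taken.
  let H : G.Subgraph := (⊤ : G.Subgraph).induce Y
  let e : o.ToType → H.verts := fun x => ⟨q x.toOrd, x.toOrd, x.toOrd.2, rfl⟩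
  have hinj : Function.Injective e := fun x y hxy =>
    ToType.mk.symm.injective (Subtype.ext (h.injOn x.toOrd.2 y.toOrd.2 (congrArg Subtype.val hxy)))
  have hsurj : Function.Surjective e := by
    rintro ⟨_, ξ, hξ, rfl⟩
    exact ⟨ToType.mk ⟨ξ, hξ⟩, Subtype.ext (by simp [e])⟩
  let E : o.ToType ≃ H.verts := Equiv.ofBijective e ⟨hinj, hsurj⟩
  let r : H.verts → H.verts → Prop := E.symm ⁻¹'o (· < ·)
  have hr : ∀ ξ η : Iio o, ∀ hξ hη, r ⟨q ξ, hξ⟩ ⟨q η, hη⟩ ↔ ξ < η := by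
    intro ξ η hξ hη
    have h1 : ∀ ξ : Iio o, ∀ hξ, E.symm ⟨q ξ, hξ⟩ = ToType.mk ξ := fun ξ hξ => by
      rw [Equiv.symm_apply_eq]
      change _ = e (ToType.mk ξ)
      exact Subtype.ext (by simp [e])
    change E.symm _ < E.symm _ ↔ _
    rw [h1, h1, OrderIso.lt_iff_lt]
  have hmem : ∀ ξ : Iio o, q ξ ∈ H.verts := fun ξ => ⟨ξ, ξ.2, rfl⟩
  have hrep : ∀ x : H.verts, ∃ ξ : Iio o, x = ⟨q ξ, hmem ξ⟩ := by
    rintro ⟨_, ξ, hξ, rfl⟩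
    exact ⟨⟨ξ, hξ⟩, rfl⟩
  have hadj : ∀ (η ξ : Iio o), ξ < η → ∃ ζ : Iio o, ξ ≤ ζ ∧ ζ < η ∧ G.Adj (q η) (q ζ) ∧
      (q ζ ∈ A ∨ (η : Ordinal) = ζ + 1) := fun η ξ hξη => by
    obtain ⟨ζ, h1, h2, h3⟩ := h.adj η η.2 ξ hξη
    exact ⟨⟨ζ, h2.trans η.2⟩, h1, h2, h3⟩
  have hwo : IsWellOrder H.verts r := (RelIso.preimage E.symm (· < ·)).toRelEmbedding.isWellOrder
  refine ⟨⟨H, r, hwo, ?_⟩, ?_, ?_, rfl, ?_⟩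
  · intro v u huv
    obtain ⟨η, rfl⟩ := hrep v
    obtain ⟨ξ, rfl⟩ := hrep u
    obtain ⟨ζ, h1, h2, h3, -⟩ := hadj η ξ ((hr ξ η _ _).1 huv)
    refine ⟨⟨q ζ, hmem ζ⟩, ⟨hmem η, hmem ζ, h3⟩, (hr _ _ _ _).2 h2, ?_⟩
    rcases h1.eq_or_lt with rfl | h1
    · exact Or.inl rfl
    · exact Or.inr ((hr _ _ _ _).2 h1)
  · change type r = o
    rw [(RelIso.preimage E.symm (· < ·)).ordinalType_congr, type_toType]
  · rintro y ⟨-, hy⟩ x hxy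
    obtain ⟨η, rfl⟩ := hrep y
    obtain ⟨ξ, rfl⟩ := hrep x
    obtain ⟨ζ, h1, h2, h3, h4⟩ := hadj η ξ ((hr ξ η _ _).1 hxy)
    refine ⟨⟨q ζ, hmem ζ⟩, h3, h4.resolve_right fun h5 => ?_, ?_, (hr _ _ _ _).2 h2⟩
    · obtain ⟨z, h6, h7⟩ := hy ⟨q ζ, hmem ζ⟩ ((hr _ _ _ _).2 h2)
      obtain ⟨ν, rfl⟩ := hrep z
      have h8 : (ζ : Ordinal) < ν := (hr _ _ _ _).1 h6
      have h9 : (ν : Ordinal) < η := (hr _ _ _ _).1 h7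
      rw [h5] at h9
      exact (Order.add_one_le_of_lt h8).not_gt h9
    · rcases h1.eq_or_lt with rfl | h1
      · exact Or.inl rfl
      · exact Or.inr ((hr _ _ _ _).2 h1)
  · intro ξ η hξ hη hlt h1 h2
    exact (hr ⟨ξ, h1⟩ ⟨η, h2⟩ _ _).1 hlt

theorem exists_radoPath_covers {G : SimpleGraph V} {κ : Cardinal.{u}} (hκ : ℵ₀ ≤ κ)
    {A : Set V} (hcard : #A = κ) (hA : IsUnseparable G κ A) {P : RadoPath G}
    (hPκ : P.orderType = κ.ord) (hP : P.ConcentratedOn A) {a : V} (ha : a ∈ A) {C : Set V}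
    (hCA : C ⊆ A) (hC : #C = κ.ord.cof) :
    ∃ Q : RadoPath G, Q.orderType = κ.ord ∧ Q.ConcentratedOn A ∧ Q.Covers A ∧
      Q.IsFirstPoint a ∧ Q.IsCofinalSet C := by
  obtain ⟨p, hp⟩ := P.exists_isSeq hP a
  rw [hPκ] at hp
  obtain ⟨q, hq, -, hqA, hq0, hqC⟩ := reroutable hκ G univ A (subset_univ A) hcard.le hA.joins p hp
    (fun _ _ => mem_univ _) a ha C hCA hC
  obtain ⟨Q, hQκ, hQA, hQv, hQlt⟩ := hq.exists_radoPath
  have hcov : Q.Covers A := fun x hx => by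
    rw [hQv]
    exact hqA x hx
  have hrep : ∀ x : Q.graph.verts, ∃ ξ < κ.ord, ∃ hξ, x = ⟨q ξ, hξ⟩ := by
    rintro ⟨x, hx⟩
    obtain ⟨ξ, hξ, rfl⟩ : x ∈ q '' Iio κ.ord := hQv ▸ hx
    exact ⟨ξ, hξ, hx, rfl⟩
  have h0 : 0 < κ.ord := (isSuccLimit_ord hκ).pos
  refine ⟨Q, hQκ, hQA, hcov, ⟨hcov ha, fun x hx => ?_⟩, hCA.trans hcov, fun x => ?_⟩
  · obtain ⟨ξ, hξ, hξ', rfl⟩ := hrep x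
    obtain ⟨η, hη, hη', he⟩ := hrep ⟨a, hcov ha⟩
    have he' : q 0 = q η := hq0.trans (congrArg Subtype.val he)
    obtain rfl := hq.injOn h0 hη he'
    rw [he] at hx
    exact not_lt_zero (hQlt _ _ _ _ hx hξ h0)
  · obtain ⟨ξ, hξ, hξ', rfl⟩ := hrep x
    obtain ⟨η, h1, h2, h3⟩ := hqC ξ hξ
    have hη' := hcov (hCA h3)
    refine ⟨⟨q η, hη'⟩, h3, ?_⟩
    rcases trichotomous_of Q.lt ⟨q ξ, hξ'⟩ ⟨q η, hη'⟩ with h | h | h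
    · exact Or.inr h
    · exact Or.inl h.symm
    · exact absurd (hQlt _ _ _ _ h h2 hξ) h1.not_gt

end TransfinitePaths

theorem lemma3p3 {V : Type u} (G : SimpleGraph V) (κ : Cardinal.{u}) (hκ : ℵ₀ ≤ κ)
    (A : Set V) (hcard : #A = κ) (hA : IsUnseparable G κ A) :
    ((∃ P : RadoPath G, P.orderType = κ.ord ∧ P.ConcentratedOn A) ↔
      (∃ Q : RadoPath G, Q.orderType = κ.ord ∧ Q.ConcentratedOn A ∧ Q.Covers A)) ∧
    ((∃ P : RadoPath G, P.orderType = κ.ord ∧ P.ConcentratedOn A) →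
      ∀ a ∈ A, ∀ C : Set V, C ⊆ A → #C = κ.ord.cof →
        ∃ Q : RadoPath G, Q.orderType = κ.ord ∧ Q.ConcentratedOn A ∧ Q.Covers A ∧
          Q.IsFirstPoint a ∧ Q.IsCofinalSet C) := by
  have key : (∃ P : RadoPath G, P.orderType = κ.ord ∧ P.ConcentratedOn A) →
      ∀ a ∈ A, ∀ C : Set V, C ⊆ A → #C = κ.ord.cof →
        ∃ Q : RadoPath G, Q.orderType = κ.ord ∧ Q.ConcentratedOn A ∧ Q.Covers A ∧
          Q.IsFirstPoint a ∧ Q.IsCofinalSet C := by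
    rintro ⟨P, hPκ, hP⟩ a ha C hCA hC
    exact exists_radoPath_covers hκ hcard hA hPκ hP ha hCA hC
  refine ⟨⟨fun h => ?_, fun ⟨Q, h1, h2, _⟩ => ⟨Q, h1, h2⟩⟩, key⟩
  obtain ⟨a, ha⟩ : A.Nonempty := by
    rw [← Set.nonempty_coe_sort, ← Cardinal.mk_ne_zero_iff, hcard]
    exact (aleph0_pos.trans_le hκ).ne'
  -- Since `cf κ ≤ κ = #A`, some admissible `C` exists, and covering follows from the stronger
  -- statement.
  obtain ⟨C, hCA, hC⟩ := Cardinal.le_mk_iff_exists_subset.1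
    ((Ordinal.cof_ord_le κ).trans hcard.ge)
  obtain ⟨Q, h1, h2, h3, -⟩ := key h a ha C hCA hC
  exact ⟨Q, h1, h2, h3⟩
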